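/- Let $R$ be a Noetherian commutative ring of Krull dimension $2$ whose spectrum $\operatorname{Spec} R$ is (at most) countable. Then there exist two (at most) countable multiplicative subsets $S_1, S_2 \subset R$ such that all flat $R$-modules are $\mathbf{S}^\times$-strongly flat for $\mathbf{S} = \{S_1, S_2\}$, in the following sense. Put $\mathbf{S}^\times = \{S_J \mid J \subset \{1,2\}\} = \{\{1\},\, S_1,\, S_2,\, S_1S_2\}$, where $S_J \subset R$ denotes the multiplicative subset generated by the subsets $S_j$ with $j \in J$ (multiplicative subsets contain $1$). An $R$-module $C$ is called $\mathbf{S}^\times$-weakly cotorsion if $\operatorname{Ext}^1_R(S_J^{-1}R, C) = 0$ for all $J \subset \{1,2\}$, and an $R$-module $F$ is called $\mathbf{S}^\times$-strongly flat if $\operatorname{Ext}^1_R(F, C) = 0$ for all $\mathbf{S}^\times$-weakly cotorsion $R$-modules $C$. -/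

import Mathlib

universe u v

/-- A module `C` over a commutative ring `R` is *weakly cotorsion* with respect to a family
`S = (S j)` of multiplicative subsets of `R` if `Ext¹_R((S j)⁻¹R, C) = 0` for all `j`.
(The `ULift` only moves the `R`-module `(S j)⁻¹R` to the universe of `C`.) -/
def IsWeaklyCotorsion {R : Type u} [CommRing R] {ι : Type*} (S : ι → Submonoid R)
    (C : ModuleCat.{max u v} R) : Prop :=
  ∀ j : ι, Subsingleton (CategoryTheory.Abelian.Ext
    (ModuleCat.of R (ULift.{v} (Localization (S j)))) C 1)

/-- A module `F` is *strongly flat* with respect to the family `S` if `Ext¹_R(F, C) = 0` for all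
`R`-modules `C` that are weakly cotorsion with respect to `S`. -/
def IsStronglyFlat {R : Type u} [CommRing R] {ι : Type*} (S : ι → Submonoid R)
    (F : ModuleCat.{max u v} R) : Prop :=
  ∀ C : ModuleCat.{max u v} R, IsWeaklyCotorsion.{u, v} S C →
    Subsingleton (CategoryTheory.Abelian.Ext F C 1)

/-- The family `𝐒^×` attached to a finite family `𝐒 = (S 0, …, S (m - 1))` of multiplicative
subsets: it is indexed by all subsets `J` of the index set, and its member `S_J` is the
multiplicative subset generated by the `S j`, `j ∈ J` (so `S_∅ = {1}`). -/
def prodFamily {R : Type u} [CommRing R] {m : ℕ} (S : Fin m → Submonoid R) :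
    Finset (Fin m) → Submonoid R :=
  fun J => ⨆ j ∈ J, S j

/-! It suffices that every `𝐒^×`-weakly cotorsion module `C` is cotorsion. For countable `S`, the
module `S⁻¹R` is the telescope of `R → R → ⋯` along a sequence `s` in `S` that absorbs every member
of `S`. Hence `Hom(S⁻¹R, C)` and `Ext¹(S⁻¹R, C)` are `lim` and `lim¹` of the tower of
multiplications by `s n` on `C`, and the hypothesis on `C` says that `lim¹` vanishes for the
sequences `s`, `t` and `s * t`.

The subsets are generated by elements found by prime avoidance along an enumeration of `Spec R`. No
minimal prime meets either subset, every nonminimal maximal ideal meets both, and every other prime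
meets exactly one. So `(ST)⁻¹R` and all `R/(a, b)` with `a ∈ S`, `b ∈ T` are Artinian, as are the
quotients of `S⁻¹R` by images of members of `T`, and symmetrically. Every module over an Artinian
ring is cotorsion, by its radical filtration, and stays so over `R`.

Let `σ n` and `τ n` be the partial products of `s` and `t`. The Koszul complexes `C → C × C → C` on
`(τ n, -σ n)` and `(σ n, τ n)` form a complex of towers with transition maps `s * t`, `(s, t)` and
the identity. Their homology is killed by `σ n` and `τ n`, hence cotorsion. Once the first two
towers have vanishing `lim¹` and cotorsion limit, so does `C` become cotorsion, being the limit of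
the last tower (`IsCotorsion.of_scaleTower_two`). For `s * t` the limit is an `(ST)⁻¹R`-module. For
`s` and `t` it is treated by the one-sequence version of the argument over `S⁻¹R` and `T⁻¹R`
(`isCotorsion_towerLimit_of_forall_lt`). -/

/-- `C` is cotorsion if `Ext¹(F, C) = 0` for every flat `F`; equivalently, every linear map to `C`
from a submodule with flat quotient of a projective module extends to the projective module. -/
def IsCotorsion (R : Type u) [CommRing R] (C : Type (max u v)) [AddCommGroup C] [Module R C] :
    Prop :=
  ∀ (K P F : Type (max u v)) [AddCommGroup K] [AddCommGroup P] [AddCommGroup F]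
    [Module R K] [Module R P] [Module R F], Module.Projective R P → Module.Flat R F →
    ∀ (i : K →ₗ[R] P) (π : P →ₗ[R] F), Function.Injective i → Function.Exact i π →
      Function.Surjective π → ∀ f : K →ₗ[R] C, ∃ g : P →ₗ[R] C, g ∘ₗ i = f

/-! ### Closure properties of cotorsion modules; modules over Artinian rings -/

section Cotorsion

variable {R : Type u} [CommRing R]

theorem Module.Flat.of_exact_of_flat {K P F : Type*} [AddCommGroup K] [AddCommGroup P]
    [AddCommGroup F] [Module R K] [Module R P] [Module R F] [Module.Flat R P] [Module.Flat R F]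
    (i : K →ₗ[R] P) (π : P →ₗ[R] F) (hi : Function.Injective i) (hex : Function.Exact i π)
    (hπ : Function.Surjective π) : Module.Flat R K := by
  rw [Module.Flat.iff_rTensor_injective']
  intro I
  have h1 : Function.Injective (i.lTensor I) :=
    LinearMap.lTensor_injective_of_exact_of_flat π hπ i hi hex I
  have h2 : Function.Injective (LinearMap.rTensor P I.subtype) :=
    Module.Flat.rTensor_preserves_injective_linearMap _ I.subtype_injective
  have h3 : (i.lTensor R) ∘ₗ (LinearMap.rTensor K I.subtype) =
      (LinearMap.rTensor P I.subtype) ∘ₗ (i.lTensor I) := by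
    rw [LinearMap.lTensor_comp_rTensor, LinearMap.rTensor_comp_lTensor]
  have h4 : Function.Injective ((i.lTensor R) ∘ₗ (LinearMap.rTensor K I.subtype)) := by
    rw [h3]; exact h2.comp h1
  exact Function.Injective.of_comp h4

namespace IsCotorsion

variable {A B C : Type (max u v)} [AddCommGroup A] [AddCommGroup B] [AddCommGroup C]
  [Module R A] [Module R B] [Module R C]

theorem of_exact_middle (hA : IsCotorsion.{u, v} R A) (hC : IsCotorsion.{u, v} R C)
    (j : A →ₗ[R] B) (p : B →ₗ[R] C) (hj : Function.Injective j) (hjp : Function.Exact j p)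
    (hp : Function.Surjective p) : IsCotorsion.{u, v} R B := by
  intro K P F _ _ _ _ _ _ hP hF i π hi hex hπ f
  obtain ⟨g, hg⟩ := hC K P F hP hF i π hi hex hπ (p ∘ₗ f)
  -- Projectivity of `P` lifts the extension from `C` to `B`; what remains to be extended takes
  -- values in `A`.
  obtain ⟨g', hg'⟩ := Module.projective_lifting_property p g hp
  have h0 : ∀ k, p ((f - g' ∘ₗ i) k) = 0 := fun k => by
    have h1 := LinearMap.congr_fun hg k
    have h2 := LinearMap.congr_fun hg' (i k)
    simp at h1 h2 ⊢
    rw [h2, h1, sub_self]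
  let e := LinearEquiv.ofInjective j hj
  let d : K →ₗ[R] A := e.symm.toLinearMap ∘ₗ
    (f - g' ∘ₗ i).codRestrict (LinearMap.range j) (fun k => (hjp _).1 (h0 k))
  have hd : ∀ k, j (d k) = f k - g' (i k) := fun k => by
    have : ∀ x, j (e.symm x) = x := fun x => congrArg Subtype.val (e.apply_symm_apply x)
    simp only [d, LinearMap.comp_apply, LinearEquiv.coe_coe, this]
    rfl
  obtain ⟨h, hh⟩ := hA K P F hP hF i π hi hex hπ d
  refine ⟨g' + j ∘ₗ h, ?_⟩
  ext k
  have := LinearMap.congr_fun hh k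
  simp at this ⊢
  rw [this, hd]; abel

/-- The obstruction to lifting lies in `Ext¹(K, A)`, which vanishes for flat `K`. Concretely, a lift
on a free cover of `K` is corrected so as to vanish on the relations. -/
theorem exists_lift (hA : IsCotorsion.{u, v} R A)
    (j : A →ₗ[R] B) (p : B →ₗ[R] C) (hj : Function.Injective j) (hjp : Function.Exact j p)
    (hp : Function.Surjective p) {K : Type (max u v)} [AddCommGroup K] [Module R K]
    [Module.Flat R K] (f : K →ₗ[R] C) : ∃ g : K →ₗ[R] B, p ∘ₗ g = f := by
  let π : (K →₀ R) →ₗ[R] K := Finsupp.linearCombination R id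
  have hπ : Function.Surjective π := fun k => ⟨Finsupp.single k 1, by simp [π]⟩
  obtain ⟨g, hg⟩ := Module.projective_lifting_property p (f ∘ₗ π) hp
  have h0 : ∀ k : LinearMap.ker π, p ((g ∘ₗ (LinearMap.ker π).subtype) k) = 0 := fun k => by
    have h2 := LinearMap.congr_fun hg k
    simpa using h2
  let e := LinearEquiv.ofInjective j hj
  let d : LinearMap.ker π →ₗ[R] A := e.symm.toLinearMap ∘ₗ
    (g ∘ₗ (LinearMap.ker π).subtype).codRestrict (LinearMap.range j) (fun k => (hjp _).1 (h0 k))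
  have hd : ∀ k, j (d k) = g k := fun k => by
    have : ∀ x, j (e.symm x) = x := fun x => congrArg Subtype.val (e.apply_symm_apply x)
    simp only [d, LinearMap.comp_apply, LinearEquiv.coe_coe, this]
    rfl
  obtain ⟨h, hh⟩ := hA (LinearMap.ker π) (K →₀ R) K inferInstance inferInstance
    (LinearMap.ker π).subtype π (LinearMap.ker π).subtype_injective
    (LinearMap.exact_subtype_ker_map π) hπ d
  have hker : LinearMap.ker π ≤ LinearMap.ker (g - j ∘ₗ h) := fun x hx => by
    have := LinearMap.congr_fun hh ⟨x, hx⟩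
    simp at this ⊢
    rw [this, hd, sub_self]
  let q := (LinearMap.ker π).liftQ (g - j ∘ₗ h) hker ∘ₗ
    (π.quotKerEquivOfSurjective hπ).symm.toLinearMap
  refine ⟨q, LinearMap.ext fun k => ?_⟩
  obtain ⟨x, rfl⟩ := hπ k
  have h1 : (π.quotKerEquivOfSurjective hπ).symm (π x) = Submodule.Quotient.mk x := by
    rw [LinearEquiv.symm_apply_eq]; rfl
  have h2 := LinearMap.congr_fun hg x
  simp at h2
  have h3 : p (j (h x)) = 0 := (hjp _).2 ⟨_, rfl⟩
  simp [q, h1, h2, h3]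

theorem of_exact_right (hA : IsCotorsion.{u, v} R A) (hB : IsCotorsion.{u, v} R B)
    (j : A →ₗ[R] B) (p : B →ₗ[R] C) (hj : Function.Injective j) (hjp : Function.Exact j p)
    (hp : Function.Surjective p) : IsCotorsion.{u, v} R C := by
  intro K P F _ _ _ _ _ _ hP hF i π hi hex hπ f
  -- A kernel of a surjection between flat modules is flat, so `f` itself lifts to `B` before being
  -- extended.
  have : Module.Flat R K := Module.Flat.of_exact_of_flat i π hi hex hπ
  obtain ⟨f', hf'⟩ := hA.exists_lift j p hj hjp hp f
  obtain ⟨g, hg⟩ := hB K P F hP hF i π hi hex hπ f'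
  exact ⟨p ∘ₗ g, by rw [LinearMap.comp_assoc, hg, hf']⟩

theorem of_equiv (hA : IsCotorsion.{u, v} R A) (e : A ≃ₗ[R] B) : IsCotorsion.{u, v} R B := by
  intro K P F _ _ _ _ _ _ hP hF i π hi hex hπ f
  obtain ⟨g, hg⟩ := hA K P F hP hF i π hi hex hπ (e.symm.toLinearMap ∘ₗ f)
  refine ⟨e.toLinearMap ∘ₗ g, ?_⟩
  rw [LinearMap.comp_assoc, hg]; ext; simp

theorem of_subsingleton [Subsingleton A] : IsCotorsion.{u, v} R A := by
  intro K P F _ _ _ _ _ _ hP hF i π hi hex hπ f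
  exact ⟨0, Subsingleton.elim _ _⟩

theorem pi {ι : Type*} {D : ι → Type (max u v)} [∀ n, AddCommGroup (D n)] [∀ n, Module R (D n)]
    (h : ∀ n, IsCotorsion.{u, v} R (D n)) (e : A ≃ₗ[R] (∀ n, D n)) : IsCotorsion.{u, v} R A := by
  intro K P F _ _ _ _ _ _ hP hF i π hi hex hπ f
  choose g hg using fun n => h n K P F hP hF i π hi hex hπ
    (LinearMap.proj n ∘ₗ e.toLinearMap ∘ₗ f)
  refine ⟨e.symm.toLinearMap ∘ₗ LinearMap.pi g, LinearMap.ext fun k => ?_⟩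
  have : LinearMap.pi g (i k) = e (f k) := by
    ext n; simpa using LinearMap.congr_fun (hg n) k
  simp [this]

theorem quotient (hB : IsCotorsion.{u, v} R B) (N : Submodule R B) (hN : IsCotorsion.{u, v} R N) :
    IsCotorsion.{u, v} R (B ⧸ N) :=
  hN.of_exact_right hB N.subtype N.mkQ N.subtype_injective (LinearMap.exact_subtype_mkQ N)
    N.mkQ_surjective

open TensorProduct in
/-- A module over an `R`-algebra is cotorsion over `R` if it is cotorsion over the algebra. -/
theorem restrictScalars {S : Type u} [CommRing S] [Algebra R S] [Module S A] [IsScalarTower R S A]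
    (hA : IsCotorsion.{u, v} S A) : IsCotorsion.{u, v} R A := by
  intro K P F _ _ _ _ _ _ hP hF i π hi hex hπ f
  -- Flatness of `F` keeps the sequence exact after base change, whatever the algebra `S`; the rest
  -- is the adjunction between base change and restriction.
  have h1 : Function.Injective (i.baseChange S) :=
    LinearMap.lTensor_injective_of_exact_of_flat π hπ i hi hex S
  have h2 : Function.Exact (i.baseChange S) (π.baseChange S) := lTensor_exact S hex hπ
  have h3 : Function.Surjective (π.baseChange S) := LinearMap.lTensor_surjective S hπ
  let f' : S ⊗[R] K →ₗ[S] A := f.liftBaseChange S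
  obtain ⟨g, hg⟩ := hA (S ⊗[R] K) (S ⊗[R] P) (S ⊗[R] F) inferInstance inferInstance
    (i.baseChange S) (π.baseChange S) h1 h2 h3 f'
  refine ⟨g.restrictScalars R ∘ₗ TensorProduct.mk R S P 1, LinearMap.ext fun k => ?_⟩
  have := LinearMap.congr_fun hg (1 ⊗ₜ k)
  simpa [f'] using this

theorem of_isSemisimpleRing [IsSemisimpleRing R] : IsCotorsion.{u, v} R A := by
  intro K P F _ _ _ _ _ _ hP hF i π hi hex hπ f
  exact IsSemisimpleModule.extension_property i hi f

theorem of_isTorsionBySet (I : Ideal R) (hI : ∀ (N : Type (max u v)) [AddCommGroup N]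
    [Module (R ⧸ I) N], IsCotorsion.{u, v} (R ⧸ I) N)
    (hA : Module.IsTorsionBySet R A I) : IsCotorsion.{u, v} R A := by
  let := hA.module
  have : IsScalarTower R (R ⧸ I) A := hA.isScalarTower
  exact (hI A).restrictScalars

/-- The Jacobson radical `J` is nilpotent, and each layer `J ^ k A / J ^ (k + 1) A` is a module over
the semisimple ring `R ⧸ J`. The induction climbs the filtration from `J ^ n A = 0`. -/
theorem of_isArtinianRing [IsArtinianRing R] : IsCotorsion.{u, v} R A := by
  let J := Ring.jacobson R
  obtain ⟨n, hn⟩ : IsNilpotent J := IsSemiprimaryRing.isNilpotent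
  have key : ∀ m : ℕ, IsCotorsion.{u, v} R (J ^ (n - m) • ⊤ : Submodule R A) := by
    intro m
    induction m with
    | zero =>
      have : (J ^ (n - 0) • ⊤ : Submodule R A) = ⊥ := by simp [hn]
      rw [this]
      exact of_subsingleton
    | succ m ih =>
      by_cases hm : n ≤ m
      · rwa [show n - (m + 1) = n - m by omega]
      have hk : n - m = (n - (m + 1)) + 1 := by omega
      rw [hk] at ih
      set k := n - (m + 1)
      have hle : (J ^ (k + 1) • ⊤ : Submodule R A) ≤ J ^ k • ⊤ :=
        Submodule.smul_mono_left (Ideal.pow_le_pow_right (Nat.le_succ k))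
      let N := (J ^ k • ⊤ : Submodule R A)
      let N' : Submodule R N := (J ^ (k + 1) • ⊤ : Submodule R A).submoduleOf N
      have hN' : IsCotorsion.{u, v} R N' := ih.of_equiv (Submodule.submoduleOfEquivOfLe hle).symm
      have hQ : IsCotorsion.{u, v} R (N ⧸ N') := by
        refine of_isTorsionBySet J (fun X _ _ => of_isSemisimpleRing) ?_
        rintro x ⟨a, ha⟩
        obtain ⟨y, rfl⟩ := N'.mkQ_surjective x
        change a • N'.mkQ y = 0
        rw [← map_smul, Submodule.mkQ_apply, Submodule.Quotient.mk_eq_zero]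
        change a • (y : A) ∈ (J ^ (k + 1) • ⊤ : Submodule R A)
        rw [pow_succ', Submodule.mul_smul]
        exact Submodule.smul_mem_smul ha y.2
      exact hN'.of_exact_middle hQ N'.subtype N'.mkQ N'.subtype_injective
        (LinearMap.exact_subtype_mkQ N') N'.mkQ_surjective
  have := key n
  rw [Nat.sub_self, pow_zero, Ideal.one_eq_top, Submodule.top_smul] at this
  exact this.of_equiv Submodule.topEquiv

end IsCotorsion

end Cotorsion

/-! ### Towers of modules, their limits and derived limits -/

section Tower

variable {R : Type u} [CommRing R]

/-- The map `∏ D n → ∏ D n`, `x ↦ (x n - φ n (x (n + 1)))`, of a tower of modules. Its kernel is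
the inverse limit of the tower and its cokernel is the first derived limit. -/
def towerShift {D : ℕ → Type*} [∀ n, AddCommGroup (D n)] [∀ n, Module R (D n)]
    (φ : ∀ n, D (n + 1) →ₗ[R] D n) : (∀ n, D n) →ₗ[R] (∀ n, D n) :=
  LinearMap.id - LinearMap.pi fun n => φ n ∘ₗ LinearMap.proj (n + 1)

@[simp]
theorem towerShift_apply {D : ℕ → Type*} [∀ n, AddCommGroup (D n)] [∀ n, Module R (D n)]
    (φ : ∀ n, D (n + 1) →ₗ[R] D n) (x : ∀ n, D n) (n : ℕ) :
    towerShift φ x n = x n - φ n (x (n + 1)) := rfl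

/-- The inverse limit of a tower of modules. -/
abbrev towerLimit {D : ℕ → Type*} [∀ n, AddCommGroup (D n)] [∀ n, Module R (D n)]
    (φ : ∀ n, D (n + 1) →ₗ[R] D n) : Submodule R (∀ n, D n) :=
  LinearMap.ker (towerShift φ)

theorem mem_towerLimit {D : ℕ → Type*} [∀ n, AddCommGroup (D n)] [∀ n, Module R (D n)]
    {φ : ∀ n, D (n + 1) →ₗ[R] D n} {x : ∀ n, D n} :
    x ∈ towerLimit φ ↔ ∀ n, x n = φ n (x (n + 1)) := by
  simp only [LinearMap.mem_ker, funext_iff, towerShift_apply, Pi.zero_apply, sub_eq_zero]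

/-- A tower whose derived limit vanishes and whose limit is cotorsion. -/
structure IsCotorsionTower {D : ℕ → Type (max u v)} [∀ n, AddCommGroup (D n)]
    [∀ n, Module R (D n)] (φ : ∀ n, D (n + 1) →ₗ[R] D n) : Prop where
  surjective : Function.Surjective (towerShift φ)
  isCotorsion : IsCotorsion.{u, v} R (towerLimit φ)

/-- The map induced on limits by a map of towers. -/
def towerLimitMap {Y B : ℕ → Type*} [∀ n, AddCommGroup (Y n)] [∀ n, AddCommGroup (B n)]
    [∀ n, Module R (Y n)] [∀ n, Module R (B n)] {φ : ∀ n, Y (n + 1) →ₗ[R] Y n}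
    {ψ : ∀ n, B (n + 1) →ₗ[R] B n} (p : ∀ n, Y n →ₗ[R] B n)
    (hp : ∀ n x, p n (φ n x) = ψ n (p (n + 1) x)) : towerLimit φ →ₗ[R] towerLimit ψ :=
  ((LinearMap.pi fun n => p n ∘ₗ LinearMap.proj n) ∘ₗ (towerLimit φ).subtype).codRestrict _
    fun x => mem_towerLimit.2 fun n => by
      have := mem_towerLimit.1 x.2 n
      simp only [LinearMap.comp_apply, LinearMap.pi_apply, LinearMap.proj_apply,
        Submodule.subtype_apply]
      rw [this, hp]

@[simp]
theorem towerLimitMap_apply {Y B : ℕ → Type*} [∀ n, AddCommGroup (Y n)]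
    [∀ n, AddCommGroup (B n)] [∀ n, Module R (Y n)] [∀ n, Module R (B n)]
    {φ : ∀ n, Y (n + 1) →ₗ[R] Y n} {ψ : ∀ n, B (n + 1) →ₗ[R] B n} (p : ∀ n, Y n →ₗ[R] B n)
    (hp : ∀ n x, p n (φ n x) = ψ n (p (n + 1) x)) (x : towerLimit φ) (n : ℕ) :
    (towerLimitMap p hp x : ∀ n, B n) n = p n ((x : ∀ n, Y n) n) := rfl

section Morphism

variable {Y B H : ℕ → Type (max u v)} [∀ n, AddCommGroup (Y n)] [∀ n, AddCommGroup (B n)]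
  [∀ n, AddCommGroup (H n)] [∀ n, Module R (Y n)] [∀ n, Module R (B n)] [∀ n, Module R (H n)]
  {φ : ∀ n, Y (n + 1) →ₗ[R] Y n} {ψ : ∀ n, B (n + 1) →ₗ[R] B n}
  {χ : ∀ n, H (n + 1) →ₗ[R] H n}

theorem towerShift_surjective_of_surjective (p : ∀ n, Y n →ₗ[R] B n)
    (hp : ∀ n x, p n (φ n x) = ψ n (p (n + 1) x)) (hsurj : ∀ n, Function.Surjective (p n))
    (h : Function.Surjective (towerShift φ)) : Function.Surjective (towerShift ψ) := by
  intro b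
  choose y hy using fun n => hsurj n (b n)
  obtain ⟨z, rfl⟩ := h y
  refine ⟨fun n => p n (z n), funext fun n => ?_⟩
  rw [towerShift_apply, ← hp, ← map_sub, ← hy, towerShift_apply]

/-- Nothing is asked of the derived limit of the kernel tower. If `Z` is the product of the kernels
and `W` its preimage under the shift on `∏ Y n`, then `W` is an extension of `Z` by `lim Y`, and
`lim B` is the quotient of `W` by `Z`. -/
theorem IsCotorsionTower.of_surjective_of_ker (hY : IsCotorsionTower.{u, v} φ)
    (p : ∀ n, Y n →ₗ[R] B n) (hp : ∀ n x, p n (φ n x) = ψ n (p (n + 1) x))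
    (hsurj : ∀ n, Function.Surjective (p n))
    (hker : ∀ n, IsCotorsion.{u, v} R (LinearMap.ker (p n))) : IsCotorsionTower.{u, v} ψ := by
  refine ⟨towerShift_surjective_of_surjective p hp hsurj hY.surjective, ?_⟩
  let pp : (∀ n, Y n) →ₗ[R] (∀ n, B n) := LinearMap.pi fun n => p n ∘ₗ LinearMap.proj n
  have hpp : ∀ y, pp (towerShift φ y) = towerShift ψ (pp y) := fun y => by
    ext n; simp [pp, hp]
  let Z := LinearMap.ker pp
  let e : Z ≃ₗ[R] (∀ n, LinearMap.ker (p n)) :=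
    { toFun := fun z n => ⟨z.1 n, congrFun z.2 n⟩
      invFun := fun z => ⟨fun n => (z n).1, funext fun n => (z n).2⟩
      map_add' := fun _ _ => rfl
      map_smul' := fun _ _ => rfl
      left_inv := fun _ => rfl
      right_inv := fun _ => rfl }
  have hZ : IsCotorsion.{u, v} R Z := IsCotorsion.pi hker e
  -- the preimage of the limit of `B` in the product of `Y`
  let W : Submodule R (∀ n, Y n) := Z.comap (towerShift φ)
  have hW : IsCotorsion.{u, v} R W := by
    refine hY.isCotorsion.of_exact_middle hZ
      (Submodule.inclusion fun x hx => ?_) ((towerShift φ).restrict fun x hx => hx)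
      (Submodule.inclusion_injective _) ?_ ?_
    · change towerShift φ x ∈ Z
      rw [LinearMap.mem_ker.1 hx]; exact Z.zero_mem
    · intro w
      constructor
      · intro h
        exact ⟨⟨w.1, congrArg Subtype.val h⟩, rfl⟩
      · rintro ⟨x, rfl⟩
        exact Subtype.ext x.2
    · intro z
      obtain ⟨y, hy⟩ := hY.surjective z.1
      exact ⟨⟨y, show towerShift φ y ∈ Z from hy ▸ z.2⟩, Subtype.ext hy⟩
  refine hZ.of_exact_right hW (Submodule.inclusion fun x hx => ?_)
    (pp.restrict fun x hx => ?_) (Submodule.inclusion_injective _) ?_ ?_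
  · change pp (towerShift φ x) = 0
    rw [hpp, LinearMap.mem_ker.1 hx, map_zero]
  · change towerShift ψ (pp x) = 0
    rw [← hpp]; exact hx
  · intro w
    constructor
    · intro h
      exact ⟨⟨w.1, congrArg Subtype.val h⟩, rfl⟩
    · rintro ⟨x, rfl⟩
      exact Subtype.ext x.2
  · intro b
    choose y hy using fun n => hsurj n (b.1 n)
    have hyb : pp y = b.1 := funext hy
    refine ⟨⟨y, ?_⟩, Subtype.ext hyb⟩
    change pp (towerShift φ y) = 0
    rw [hpp, hyb]; exact b.2

variable (i : ∀ n, B n →ₗ[R] Y n) (p : ∀ n, Y n →ₗ[R] H n)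
  (hi : ∀ n x, i n (ψ n x) = φ n (i (n + 1) x)) (hp : ∀ n x, p n (φ n x) = χ n (p (n + 1) x))
  (hinj : ∀ n, Function.Injective (i n)) (hex : ∀ n, Function.Exact (i n) (p n))
  (hsurj : ∀ n, Function.Surjective (p n))

include hinj in
theorem towerLimitMap_injective : Function.Injective (towerLimitMap i hi) := by
  intro x y h
  refine Subtype.ext (funext fun n => hinj n ?_)
  exact congrFun (congrArg Subtype.val h) n

include hinj hex in
theorem towerLimitMap_exact : Function.Exact (towerLimitMap i hi) (towerLimitMap p hp) := by
  intro y
  constructor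
  · intro h
    choose b hb using fun n => (hex n (y.1 n)).1 (congrFun (congrArg Subtype.val h) n)
    refine ⟨⟨b, mem_towerLimit.2 fun n => hinj n ?_⟩, Subtype.ext (funext hb)⟩
    rw [hi, hb, hb]
    exact mem_towerLimit.1 y.2 n
  · rintro ⟨x, rfl⟩
    exact Subtype.ext (funext fun n => (hex n _).2 ⟨x.1 n, rfl⟩)

-- A compatible family in `H` lifts termwise to `Y`; the failure of compatibility lies in `B` and is
-- removed by solving the shift equation there.
include hi hex hsurj in
theorem towerLimitMap_surjective (hB : Function.Surjective (towerShift ψ)) :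
    Function.Surjective (towerLimitMap p hp) := by
  intro h
  choose y hy using fun n => hsurj n (h.1 n)
  have h0 : ∀ n, p n (towerShift φ y n) = 0 := fun n => by
    rw [towerShift_apply, map_sub, hp, hy, hy, sub_eq_zero]
    exact mem_towerLimit.1 h.2 n
  choose c hc using fun n => (hex n _).1 (h0 n)
  obtain ⟨b, rfl⟩ := hB c
  refine ⟨⟨fun n => y n - i n (b n), mem_towerLimit.2 fun n => ?_⟩,
    Subtype.ext (funext fun n => ?_)⟩
  · have := hc n
    rw [towerShift_apply, towerShift_apply, map_sub, hi, sub_eq_sub_iff_add_eq_add] at this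
    rw [map_sub, sub_eq_sub_iff_add_eq_add, ← this, add_comm]
  · have : p n (i n (b n)) = 0 := (hex n _).2 ⟨_, rfl⟩
    simp [this, hy]

include hi hp hinj hex hsurj in
theorem IsCotorsionTower.of_exact_right (hB : IsCotorsionTower.{u, v} ψ)
    (hY : IsCotorsionTower.{u, v} φ) : IsCotorsionTower.{u, v} χ :=
  ⟨towerShift_surjective_of_surjective p hp hsurj hY.surjective,
    hB.isCotorsion.of_exact_right hY.isCotorsion _ _ (towerLimitMap_injective i hi hinj)
      (towerLimitMap_exact i p hi hp hinj hex)
      (towerLimitMap_surjective i p hi hp hex hsurj hB.surjective)⟩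

include hi hp hinj hex hsurj in
theorem IsCotorsionTower.isCotorsion_of_exact_middle (hB : IsCotorsionTower.{u, v} ψ)
    (hH : IsCotorsion.{u, v} R (towerLimit χ)) : IsCotorsion.{u, v} R (towerLimit φ) :=
  hB.isCotorsion.of_exact_middle hH _ _ (towerLimitMap_injective i hi hinj)
    (towerLimitMap_exact i p hi hp hinj hex)
    (towerLimitMap_surjective i p hi hp hex hsurj hB.surjective)

theorem IsCotorsionTower.prod (hY : IsCotorsionTower.{u, v} φ) (hB : IsCotorsionTower.{u, v} ψ) :
    IsCotorsionTower.{u, v} (D := fun n => Y n × B n) fun n => (φ n).prodMap (ψ n) := by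
  constructor
  · intro x
    obtain ⟨y, hy⟩ := hY.surjective fun n => (x n).1
    obtain ⟨b, hb⟩ := hB.surjective fun n => (x n).2
    exact ⟨fun n => (y n, b n), funext fun n => Prod.ext (congrFun hy n) (congrFun hb n)⟩
  · have h : IsCotorsion.{u, v} R (towerLimit φ × towerLimit ψ) :=
      hY.isCotorsion.of_exact_middle hB.isCotorsion (LinearMap.inl R _ _) (LinearMap.snd R _ _)
        LinearMap.inl_injective Function.Exact.inl_snd LinearMap.snd_surjective
    refine h.of_equiv
      { toFun := fun x => ⟨fun n => (x.1.1 n, x.2.1 n), mem_towerLimit.2 fun n =>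
          Prod.ext (mem_towerLimit.1 x.1.2 n) (mem_towerLimit.1 x.2.2 n)⟩
        invFun := fun x => (⟨fun n => (x.1 n).1, mem_towerLimit.2 fun n =>
          congrArg Prod.fst (mem_towerLimit.1 x.2 n)⟩, ⟨fun n => (x.1 n).2,
          mem_towerLimit.2 fun n => congrArg Prod.snd (mem_towerLimit.1 x.2 n)⟩)
        map_add' := fun _ _ => rfl
        map_smul' := fun _ _ => rfl
        left_inv := fun _ => rfl
        right_inv := fun _ => rfl }

end Morphism

/-- The limit of a tower is cotorsion if all submodules of its members are cotorsion. -/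
theorem isCotorsion_towerLimit {D : ℕ → Type (max u v)} [∀ n, AddCommGroup (D n)]
    [∀ n, Module R (D n)] (φ : ∀ n, D (n + 1) →ₗ[R] D n)
    (h : ∀ n (N : Submodule R (D n)), IsCotorsion.{u, v} R N) :
    IsCotorsion.{u, v} R (towerLimit φ) := by
  intro K P F _ _ _ _ _ _ hP hF i π hi hex hπ f
  -- `g` extends `f` in degrees below `n`
  let Good (n : ℕ) (g : P →ₗ[R] towerLimit φ) : Prop := ∀ k, ∀ j < n, (g (i k)).1 j = (f k).1 j
  have step : ∀ n (g : P →ₗ[R] towerLimit φ), Good n g →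
      ∃ g' : P →ₗ[R] towerLimit φ, Good (n + 1) g' ∧ ∀ p, ∀ j < n, (g' p).1 j = (g p).1 j := by
    intro n g hg
    -- The error `f - g ∘ₗ i` takes values in `G`. Its coordinate `n` is extended to `P` inside the
    -- image of `G` in `D n`, then lifted back to `G`, so the correction leaves the earlier
    -- coordinates alone.
    let G : Submodule R (towerLimit φ) :=
      { carrier := {x | ∀ j < n, x.1 j = 0}
        add_mem' := fun {a b} ha hb j hj => by
          change a.1 j + b.1 j = 0
          rw [ha j hj, hb j hj, add_zero]
        zero_mem' := fun _ _ => rfl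
        smul_mem' := fun c x hx j hj => by
          change c • x.1 j = 0
          rw [hx j hj, smul_zero] }
    let q : G →ₗ[R] D n := LinearMap.proj n ∘ₗ (towerLimit φ).subtype ∘ₗ G.subtype
    let d : K →ₗ[R] G := (f - g ∘ₗ i).codRestrict G fun k j hj => by
      change (f k).1 j - (g (i k)).1 j = 0
      rw [hg k j hj, sub_self]
    obtain ⟨t, ht⟩ := h n (LinearMap.range q) K P F hP hF i π hi hex hπ (q.rangeRestrict ∘ₗ d)
    obtain ⟨t', ht'⟩ := Module.projective_lifting_property q.rangeRestrict t
      q.surjective_rangeRestrict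
    refine ⟨g + G.subtype ∘ₗ t', fun k j hj => ?_, fun p j hj => ?_⟩
    · rcases Nat.lt_succ_iff_lt_or_eq.1 hj with hj | rfl
      · change (g (i k)).1 j + (t' (i k)).1.1 j = _
        rw [(t' (i k)).2 j hj, hg k j hj, add_zero]
      · change (g (i k)).1 j + (t' (i k)).1.1 j = _
        have h1 := congrArg Subtype.val (LinearMap.congr_fun ht' (i k))
        have h2 := congrArg Subtype.val (LinearMap.congr_fun ht k)
        have h3 : (t' (i k)).1.1 j = (f k).1 j - (g (i k)).1 j := h1.trans h2
        rw [h3, add_sub_cancel]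
    · change (g p).1 j + (t' p).1.1 j = _
      rw [(t' p).2 j hj, add_zero]
  choose nxt hnxt hnxt' using step
  let s : ∀ n, {g // Good n g} := fun n => Nat.rec ⟨0, fun _ j hj => absurd hj (Nat.not_lt_zero j)⟩
    (fun n g => ⟨nxt n g.1 g.2, hnxt n g.1 g.2⟩) n
  have hs : ∀ n p, ∀ j < n, ((s (n + 1)).1 p).1 j = ((s n).1 p).1 j :=
    fun n p j hj => hnxt' n (s n).1 (s n).2 p j hj
  let g : P →ₗ[R] (∀ n, D n) := LinearMap.pi fun n =>
    LinearMap.proj n ∘ₗ (towerLimit φ).subtype ∘ₗ (s (n + 1)).1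
  refine ⟨g.codRestrict _ fun p => mem_towerLimit.2 fun n => ?_,
    LinearMap.ext fun k => Subtype.ext (funext fun n => (s (n + 1)).2 k n (Nat.lt_succ_self n))⟩
  change ((s (n + 1)).1 p).1 n = φ n (((s (n + 2)).1 p).1 (n + 1))
  -- Coordinate `n` is final from stage `n + 1` on, so coordinates `n` and `n + 1` can both be read
  -- off at stage `n + 2`, which takes values in the limit.
  rw [← hs (n + 1) p n (Nat.lt_succ_self n)]
  exact mem_towerLimit.1 ((s (n + 2)).1 p).2 n

end Tower

/-! ### Images and cokernels of maps of towers -/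

section TowerComplex

variable {R : Type u} [CommRing R] {Y X : ℕ → Type (max u v)} [∀ n, AddCommGroup (Y n)]
  [∀ n, AddCommGroup (X n)] [∀ n, Module R (Y n)] [∀ n, Module R (X n)]
  {φ : ∀ n, Y (n + 1) →ₗ[R] Y n} {χ : ∀ n, X (n + 1) →ₗ[R] X n}
  (d : ∀ n, Y n →ₗ[R] X n) (hd : ∀ n y, d n (φ n y) = χ n (d (n + 1) y))

include hd in
theorem map_mem_range_of_towerMap (n : ℕ) (x : X (n + 1))
    (hx : x ∈ LinearMap.range (d (n + 1))) : χ n x ∈ LinearMap.range (d n) := by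
  obtain ⟨y, rfl⟩ := hx
  exact ⟨φ n y, hd n y⟩

theorem IsCotorsionTower.range (hY : IsCotorsionTower.{u, v} φ)
    (hker : ∀ n, IsCotorsion.{u, v} R (LinearMap.ker (d n))) :
    IsCotorsionTower.{u, v} (D := fun n => LinearMap.range (d n)) fun n =>
      (χ n).restrict (map_mem_range_of_towerMap d hd n) := by
  refine hY.of_surjective_of_ker (fun n => (d n).rangeRestrict)
    (fun n x => Subtype.ext (hd n x)) (fun n => (d n).surjective_rangeRestrict) fun n => ?_
  rw [LinearMap.ker_rangeRestrict]
  exact hker n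

theorem IsCotorsionTower.cokernel (hY : IsCotorsionTower.{u, v} φ)
    (hX : IsCotorsionTower.{u, v} χ) (hker : ∀ n, IsCotorsion.{u, v} R (LinearMap.ker (d n))) :
    IsCotorsionTower.{u, v} (D := fun n => X n ⧸ LinearMap.range (d n)) fun n =>
      Submodule.mapQ _ _ (χ n) (map_mem_range_of_towerMap d hd n) :=
  IsCotorsionTower.of_exact_right (fun n => (LinearMap.range (d n)).subtype)
    (fun n => (LinearMap.range (d n)).mkQ) (fun _ _ => rfl) (fun _ _ => rfl)
    (fun n => (LinearMap.range (d n)).subtype_injective)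
    (fun n => LinearMap.exact_subtype_mkQ (LinearMap.range (d n)))
    (fun n => (LinearMap.range (d n)).mkQ_surjective) (hY.range d hd hker) hX

-- The image tower has a cotorsion limit and no derived limit, so `lim X` is an extension of the
-- limit of the cokernels by the limit of the images. The limit of the cokernels is cotorsion by
-- successive correction, with no condition on its derived limit.
include hd in
theorem IsCotorsionTower.isCotorsion_towerLimit_of_cokernel (hY : IsCotorsionTower.{u, v} φ)
    (hker : ∀ n, IsCotorsion.{u, v} R (LinearMap.ker (d n)))
    (hcoker : ∀ n (N : Submodule R (X n ⧸ LinearMap.range (d n))), IsCotorsion.{u, v} R N) :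
    IsCotorsion.{u, v} R (towerLimit χ) :=
  IsCotorsionTower.isCotorsion_of_exact_middle (fun n => (LinearMap.range (d n)).subtype)
    (fun n => (LinearMap.range (d n)).mkQ) (fun _ _ => rfl)
    (χ := fun n => Submodule.mapQ _ _ (χ n) (map_mem_range_of_towerMap d hd n)) (fun _ _ => rfl)
    (fun n => (LinearMap.range (d n)).subtype_injective)
    (fun n => LinearMap.exact_subtype_mkQ (LinearMap.range (d n)))
    (fun n => (LinearMap.range (d n)).mkQ_surjective) (hY.range d hd hker)
    (isCotorsion_towerLimit _ hcoker)

end TowerComplex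

/-! ### Multiplication towers and the Koszul comparison with the constant tower -/

section ScaleTower

variable {R : Type u} [CommRing R]

/-- The constant family of modules. -/
abbrev constFamily (C : Type*) : ℕ → Type _ := fun _ => C

/-- The tower `⋯ → C → C → C` of multiplications by the members of a sequence of scalars. -/
def scaleTower (C : Type*) [AddCommGroup C] [Module R C] (s : ℕ → R) (n : ℕ) :
    constFamily C (n + 1) →ₗ[R] constFamily C n :=
  LinearMap.lsmul R C (s n)

@[simp]
theorem scaleTower_apply (C : Type*) [AddCommGroup C] [Module R C] (s : ℕ → R) (n : ℕ) (c : C) :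
    scaleTower C s n c = s n • c := rfl

/-- The product of the first `n` members of a sequence. -/
def partialProd (s : ℕ → R) (n : ℕ) : R := ∏ k ∈ Finset.range n, s k

theorem partialProd_succ (s : ℕ → R) (n : ℕ) : partialProd s (n + 1) = partialProd s n * s n :=
  Finset.prod_range_succ s n

variable {C : Type (max u v)} [AddCommGroup C] [Module R C]

theorem IsCotorsion.of_towerLimit_const
    (h : IsCotorsion.{u, v} R (towerLimit (D := constFamily C) fun _ => LinearMap.id (R := R))) :
    IsCotorsion.{u, v} R C := by
  refine h.of_equiv
    { toFun := fun x => x.1 0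
      invFun := fun c => ⟨fun _ => c, mem_towerLimit.2 fun _ => rfl⟩
      map_add' := fun _ _ => rfl
      map_smul' := fun _ _ => rfl
      left_inv := fun x => Subtype.ext (funext fun n => ?_)
      right_inv := fun _ => rfl }
  induction n with
  | zero => rfl
  | succ n ih => exact ih.trans (mem_towerLimit.1 x.2 n)

/-- Multiplication by the partial products maps the tower to the constant tower with limit `C`; its
kernels and cokernels are killed by those products. -/
theorem IsCotorsion.of_scaleTower (s : ℕ → R) (hC : IsCotorsionTower.{u, v} (scaleTower C s))
    (hs : ∀ n (N : Type (max u v)) [AddCommGroup N] [Module R N],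
      (∀ x : N, partialProd s n • x = 0) → IsCotorsion.{u, v} R N) : IsCotorsion.{u, v} R C := by
  let d : ∀ n : ℕ, constFamily C n →ₗ[R] constFamily C n := fun n =>
    LinearMap.lsmul R C (partialProd s n)
  have hd : ∀ n (y : C), d n (scaleTower C s n y) =
      (LinearMap.id : constFamily C (n + 1) →ₗ[R] constFamily C n) (d (n + 1) y) := fun n y => by
    change partialProd s n • s n • y = partialProd s (n + 1) • y
    rw [partialProd_succ, mul_smul]
  have hker : ∀ n, IsCotorsion.{u, v} R (LinearMap.ker (d n)) := fun n =>
    hs n _ fun x => Subtype.ext x.2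
  have hcoker : ∀ n (N : Submodule R (constFamily C n ⧸ LinearMap.range (d n))),
      IsCotorsion.{u, v} R N := by
    intro n N
    refine hs n _ ?_
    rintro ⟨x, hx⟩
    obtain ⟨c, rfl⟩ := Submodule.mkQ_surjective _ x
    exact Subtype.ext ((Submodule.Quotient.mk_eq_zero _).2 ⟨c, rfl⟩)
  exact of_towerLimit_const (hC.isCotorsion_towerLimit_of_cokernel d hd hker hcoker)

theorem IsCotorsion.of_scaleTower_two (s t : ℕ → R)
    (hst : IsCotorsionTower.{u, v} (scaleTower C (s * t)))
    (hs : IsCotorsionTower.{u, v} (scaleTower C s))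
    (ht : IsCotorsionTower.{u, v} (scaleTower C t))
    (h : ∀ n (N : Type (max u v)) [AddCommGroup N] [Module R N],
      (∀ x : N, partialProd s n • x = 0) → (∀ x : N, partialProd t n • x = 0) →
        IsCotorsion.{u, v} R N) : IsCotorsion.{u, v} R C := by
  obtain ⟨σ, hσ'⟩ : ∃ σ, σ = partialProd s := ⟨_, rfl⟩
  obtain ⟨τ, hτ'⟩ : ∃ τ, τ = partialProd t := ⟨_, rfl⟩
  rw [← hσ', ← hτ'] at h
  have hσ : ∀ n, σ (n + 1) = σ n * s n := hσ' ▸ partialProd_succ s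
  have hτ : ∀ n, τ (n + 1) = τ n * t n := hτ' ▸ partialProd_succ t
  -- The maps `d n` and `e n` form the Koszul complex of `σ n` and `τ n`. The cross terms `τ n` and
  -- `-σ n` make `d` commute with the transitions `s * t` and `(s, t)`.
  let d : ∀ n : ℕ, constFamily C n →ₗ[R] constFamily C n × constFamily C n := fun n =>
    (LinearMap.lsmul R C (τ n)).prod (LinearMap.lsmul R C (-σ n))
  have hd_apply : ∀ n (c : C), d n c = (τ n • c, -σ n • c) := fun _ _ => rfl
  let e : ∀ n : ℕ, constFamily C n × constFamily C n →ₗ[R] constFamily C n := fun n =>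
    (LinearMap.lsmul R C (σ n)).coprod (LinearMap.lsmul R C (τ n))
  have he_apply : ∀ n (x : C × C), e n x = σ n • x.1 + τ n • x.2 := fun _ _ => rfl
  have hd : ∀ n (y : C), d n (scaleTower C (s * t) n y) =
      ((scaleTower C s n).prodMap (scaleTower C t n)) (d (n + 1) y) := fun n y => by
    refine Prod.ext ?_ ?_
    · change τ n • (s n * t n) • y = s n • τ (n + 1) • y
      rw [hτ, smul_smul, smul_smul]; congr 1; ring
    · change -σ n • (s n * t n) • y = t n • -σ (n + 1) • y
      rw [hσ, smul_smul, smul_smul]; congr 1; ring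
  have hker : ∀ n, IsCotorsion.{u, v} R (LinearMap.ker (d n)) := fun n => by
    have h0 : ∀ x : LinearMap.ker (d n), τ n • x.1 = 0 ∧ -σ n • x.1 = 0 := fun x =>
      Prod.ext_iff.1 x.2
    refine h n _ (fun x => Subtype.ext ?_) fun x => Subtype.ext (h0 x).1
    exact neg_eq_zero.1 ((neg_smul _ _).symm.trans (h0 x).2)
  have hed : ∀ n, LinearMap.range (d n) ≤ LinearMap.ker (e n) := by
    rintro n _ ⟨c, rfl⟩
    rw [LinearMap.mem_ker, hd_apply, he_apply]
    change σ n • τ n • c + τ n • -σ n • c = 0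
    rw [smul_smul, smul_smul, ← add_smul, mul_neg, mul_comm, add_neg_cancel, zero_smul]
  let e' : ∀ n : ℕ, ((constFamily C n × constFamily C n) ⧸ LinearMap.range (d n)) →ₗ[R]
    constFamily C n := fun n => (LinearMap.range (d n)).liftQ (e n) (hed n)
  have hXtower := hst.cokernel d hd (hs.prod ht) hker
  have he' : ∀ n (y : (constFamily C (n + 1) × constFamily C (n + 1)) ⧸
      LinearMap.range (d (n + 1))),
      e' n (Submodule.mapQ _ _ ((scaleTower C s n).prodMap (scaleTower C t n))
        (map_mem_range_of_towerMap d hd n) y) =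
      (LinearMap.id : constFamily C (n + 1) →ₗ[R] constFamily C n) (e' (n + 1) y) := by
    intro n y
    obtain ⟨x, rfl⟩ := Submodule.mkQ_surjective _ y
    change σ n • s n • x.1 + τ n • t n • x.2 = σ (n + 1) • x.1 + τ (n + 1) • x.2
    rw [hσ, hτ, mul_smul, mul_smul]
  -- The Koszul homotopies: on a cycle `x`, multiplication by `σ n` is `d n (-x.2)` and
  -- multiplication by `τ n` is `d n x.1`.
  have hrange : ∀ n (x : C × C), e n x = 0 →
      σ n • x ∈ LinearMap.range (d n) ∧ τ n • x ∈ LinearMap.range (d n) := fun n x hx => by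
    rw [he_apply] at hx
    refine ⟨⟨-x.2, Prod.ext ?_ ?_⟩, ⟨x.1, Prod.ext rfl ?_⟩⟩
    · change τ n • -x.2 = σ n • x.1
      rw [smul_neg, eq_comm]; exact eq_neg_of_add_eq_zero_left hx
    · change -σ n • -x.2 = σ n • x.2
      rw [smul_neg, neg_smul, neg_neg]
    · change -σ n • x.1 = τ n • x.2
      rw [neg_smul, neg_eq_iff_add_eq_zero]; exact hx
  have hker' : ∀ n, IsCotorsion.{u, v} R (LinearMap.ker (e' n)) := fun n => by
    refine h n _ ?_ ?_
    all_goals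
      rintro ⟨y, hy⟩
      obtain ⟨x, rfl⟩ := Submodule.mkQ_surjective _ y
    · exact Subtype.ext ((Submodule.Quotient.mk_eq_zero _).2 (hrange n x hy).1)
    · exact Subtype.ext ((Submodule.Quotient.mk_eq_zero _).2 (hrange n x hy).2)
  have hcoker : ∀ n (N : Submodule R (constFamily C n ⧸ LinearMap.range (e' n))),
      IsCotorsion.{u, v} R N := by
    intro n N
    have h1 : ∀ c : C, σ n • c ∈ LinearMap.range (e' n) := fun c =>
      ⟨Submodule.Quotient.mk (c, 0), show σ n • c + τ n • (0 : C) = _ by simp⟩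
    have h2 : ∀ c : C, τ n • c ∈ LinearMap.range (e' n) := fun c =>
      ⟨Submodule.Quotient.mk (0, c), show σ n • (0 : C) + τ n • c = _ by simp⟩
    refine h n _ ?_ ?_
    all_goals
      rintro ⟨x, hx⟩
      obtain ⟨c, rfl⟩ := Submodule.mkQ_surjective _ x
    · exact Subtype.ext ((Submodule.Quotient.mk_eq_zero _).2 (h1 c))
    · exact Subtype.ext ((Submodule.Quotient.mk_eq_zero _).2 (h2 c))
  exact of_towerLimit_const (hXtower.isCotorsion_towerLimit_of_cokernel e' he' hker' hcoker)

/-- The derived limit of the tower of multiplications by `t` on the limit of the tower of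
multiplications by `s` vanishes if that of the tower of multiplications by `s * t` does. -/
theorem towerShift_scaleTower_towerLimit_surjective (s t : ℕ → R)
    (h : Function.Surjective (towerShift (scaleTower C (s * t)))) :
    Function.Surjective (towerShift (scaleTower (towerLimit (scaleTower C s)) t)) := by
  intro m
  -- The unknown is an array `b n k` with `b n k = s k • b n (k + 1)` and `b n k = m n k + t n • b
  -- (n + 1) k`. Its diagonal must solve the shift equation for `s * t`; a diagonal solution then
  -- determines all other entries.
  obtain ⟨c, hc⟩ := h fun n => (m n).1 n
  have hc' : ∀ n, c n = (m n).1 n + (s n * t n) • c (n + 1) := fun n => by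
    rw [← congrFun hc n]; simp
  have hm : ∀ n k, (m n).1 k = s k • (m n).1 (k + 1) := fun n k => mem_towerLimit.1 (m n).2 k
  -- `up j n` is the component of index `n + j` of the member `n` of the solution
  obtain ⟨up, up_zero, up_succ⟩ : ∃ up : ℕ → ℕ → C, (∀ n, up 0 n = c n) ∧
      ∀ j n, up (j + 1) n = (m n).1 (n + j + 1) + t n • up j (n + 1) :=
    ⟨fun j => Nat.rec (fun n => c n) (fun j f n => (m n).1 (n + j + 1) + t n • f (n + 1)) j,
      fun _ => rfl, fun _ _ => rfl⟩
  have up_compat : ∀ j n, up j n = s (n + j) • up (j + 1) n := by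
    intro j
    induction j with
    | zero =>
      intro n
      rw [up_succ, up_zero, up_zero, smul_add, smul_smul, add_zero, ← hm]
      exact hc' n
    | succ j ih =>
      intro n
      rw [up_succ, up_succ (j + 1), ih (n + 1), smul_add, ← add_assoc n j 1, ← hm,
        smul_comm (s _), add_right_comm n 1 j]
  -- `down j k` is the component of index `k` of the member `k + j` of the solution
  obtain ⟨down, down_zero, down_succ⟩ : ∃ down : ℕ → ℕ → C, (∀ k, down 0 k = c k) ∧
      ∀ j k, down (j + 1) k = s k • down j (k + 1) :=
    ⟨fun j => Nat.rec (fun k => c k) (fun _ f k => s k • f (k + 1)) j,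
      fun _ => rfl, fun _ _ => rfl⟩
  have down_shift : ∀ j k, down j k = (m (k + j)).1 k + t (k + j) • down (j + 1) k := by
    intro j
    induction j with
    | zero =>
      intro k
      rw [down_succ, down_zero, down_zero, smul_smul, mul_comm]
      exact hc' k
    | succ j ih =>
      intro k
      rw [down_succ, down_succ (j + 1), ih (k + 1), smul_add, smul_comm (s k), ← hm,
        add_assoc, add_comm 1 j]
  let b : ℕ → ℕ → C := fun n k => if n ≤ k then up (k - n) n else down (n - k) k
  have hb : ∀ n k, b n k = s k • b n (k + 1) := by
    intro n k
    rcases Nat.lt_or_ge k n with hk | hk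
    · obtain ⟨j, rfl⟩ := Nat.exists_eq_add_of_lt hk
      have h1 : b (k + j + 1) k = down (j + 1) k := by
        simp only [b]; rw [if_neg (by omega), show k + j + 1 - k = j + 1 by omega]
      rw [h1, down_succ]
      congr 1
      rcases j with _ | j
      · simp [b, up_zero, down_zero]
      · simp only [b]; rw [if_neg (by omega), show k + (j + 1) + 1 - (k + 1) = j + 1 by omega]
    · obtain ⟨j, rfl⟩ := Nat.exists_eq_add_of_le hk
      simp only [b]
      rw [if_pos (by omega), if_pos (by omega), show n + j - n = j by omega,
        show n + j + 1 - n = j + 1 by omega, up_compat]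
  refine ⟨fun n => ⟨b n, mem_towerLimit.2 (hb n)⟩,
    funext fun n => Subtype.ext (funext fun k => ?_)⟩
  change b n k - t n • b (n + 1) k = (m n).1 k
  rw [sub_eq_iff_eq_add]
  rcases Nat.lt_or_ge n k with hk | hk
  · obtain ⟨j, rfl⟩ := Nat.exists_eq_add_of_lt hk
    simp only [b]
    rw [if_pos (by omega), if_pos (by omega), show n + j + 1 - n = j + 1 by omega,
      show n + j + 1 - (n + 1) = j by omega, up_succ]
  · obtain ⟨j, rfl⟩ := Nat.exists_eq_add_of_le hk
    have h1 : b (k + j) k = down j k := by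
      rcases j with _ | j
      · simp [b, up_zero, down_zero]
      · simp only [b]; rw [if_neg (by omega), show k + (j + 1) - k = j + 1 by omega]
    have h2 : b (k + j + 1) k = down (j + 1) k := by
      simp only [b]; rw [if_neg (by omega), show k + j + 1 - k = j + 1 by omega]
    rw [h1, h2, down_shift]

end ScaleTower

/-! ### Localizations at countable multiplicative subsets as telescopes -/

section Exhausting

variable {R : Type u} [CommRing R]

/-- A sequence of members of `S` is exhausting if every member of `S` divides a product of
consecutive terms of it, starting from any given position. -/
structure IsExhausting (S : Submonoid R) (s : ℕ → R) : Prop where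
  mem : ∀ n, s n ∈ S
  dvd : ∀ u ∈ S, ∀ n, ∃ m, u ∣ ∏ k ∈ Finset.range m, s (n + k)

theorem exists_isExhausting (S : Submonoid R) (hS : (S : Set R).Countable) :
    ∃ s, IsExhausting S s := by
  have : Countable S := hS
  -- The factor `ℕ` makes each member of `S` occur infinitely often, hence beyond any given
  -- position.
  obtain ⟨f, hf⟩ := exists_surjective_nat (S × ℕ)
  refine ⟨fun n => (f n).1.1, fun n => (f n).1.2, fun u hu n => ?_⟩
  have hinf : (f ⁻¹' (Set.range fun k : ℕ => ((⟨u, hu⟩ : S), k))).Infinite :=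
    (Set.infinite_range_of_injective fun a b h => (Prod.ext_iff.1 h).2).preimage
      fun x _ => hf x
  obtain ⟨m, ⟨k, hk⟩, hm⟩ := hinf.exists_gt n
  refine ⟨m - n + 1, ?_⟩
  have h1 : u = (f (n + (m - n))).1.1 := by
    rw [Nat.add_sub_cancel' hm.le, ← hk]
  rw [h1]
  exact Finset.dvd_prod_of_mem (fun k => ((f (n + k)).1 : R))
    (Finset.mem_range.2 (Nat.lt_succ_self _))

theorem IsExhausting.mul {S T : Submonoid R} {s t : ℕ → R} (hs : IsExhausting S s)
    (ht : IsExhausting T t) : IsExhausting (S ⊔ T) (s * t) := by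
  refine ⟨fun n => (S ⊔ T).mul_mem (Submonoid.mem_sup_left (hs.mem n))
    (Submonoid.mem_sup_right (ht.mem n)), fun u hu n => ?_⟩
  obtain ⟨a, ha, b, hb, rfl⟩ := Submonoid.mem_sup.1 hu
  obtain ⟨m, hm⟩ := hs.dvd a ha n
  obtain ⟨m', hm'⟩ := ht.dvd b hb n
  refine ⟨max m m', ?_⟩
  simp only [Pi.mul_apply, Finset.prod_mul_distrib]
  exact mul_dvd_mul
    (hm.trans (Finset.prod_dvd_prod_of_subset _ _ _ (Finset.range_mono (le_max_left _ _))))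
    (hm'.trans (Finset.prod_dvd_prod_of_subset _ _ _ (Finset.range_mono (le_max_right _ _))))

theorem IsExhausting.map {A : Type*} [CommRing A] (f : R →+* A) {S : Submonoid R} {s : ℕ → R}
    (hs : IsExhausting S s) : IsExhausting (S.map f) (fun n => f (s n)) := by
  refine ⟨fun n => ⟨s n, hs.mem n, rfl⟩, ?_⟩
  rintro _ ⟨u, hu, rfl⟩ n
  obtain ⟨m, hm⟩ := hs.dvd u hu n
  exact ⟨m, by simpa using map_dvd f hm⟩

theorem partialProd_add (s : ℕ → R) (n m : ℕ) :
    partialProd s (n + m) = partialProd s n * ∏ k ∈ Finset.range m, s (n + k) :=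
  Finset.prod_range_add s n m

theorem IsExhausting.partialProd_mem {S : Submonoid R} {s : ℕ → R} (hs : IsExhausting S s)
    (n : ℕ) : partialProd s n ∈ S :=
  S.prod_mem fun k _ => hs.mem k

/-- The map `e n ↦ e n - s n • e (n + 1)` on a free module of countable rank. -/
noncomputable def telescopeMap (s : ℕ → R) : (ℕ →₀ R) →ₗ[R] (ℕ →₀ R) :=
  Finsupp.linearCombination R fun n => Finsupp.single n 1 - s n • Finsupp.single (n + 1) 1

theorem telescopeMap_single (s : ℕ → R) (n : ℕ) : telescopeMap s (Finsupp.single n 1) =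
    Finsupp.single n 1 - s n • Finsupp.single (n + 1) 1 := by
  simp [telescopeMap]

theorem telescopeMap_injective (s : ℕ → R) : Function.Injective (telescopeMap s) := by
  have h0 : ∀ x, telescopeMap s x 0 = x 0 := fun x => by
    induction x using Finsupp.induction_linear with
    | zero => simp
    | add x y hx hy => simp [hx, hy]
    | single n r => simp [telescopeMap, Finsupp.single_apply]
  have hsucc : ∀ x n, telescopeMap s x (n + 1) = x (n + 1) - s n * x n := fun x n => by
    induction x using Finsupp.induction_linear with
    | zero => simp
    | add x y hx hy => simp only [map_add, Finsupp.add_apply, hx, hy]; ring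
    | single k r =>
      simp only [telescopeMap, Finsupp.linearCombination_single, Finsupp.smul_apply,
        Finsupp.sub_apply, Finsupp.single_apply, smul_eq_mul, Nat.succ_inj]
      split_ifs with h1 h2 <;> simp_all [mul_comm]
  rw [← LinearMap.ker_eq_bot, LinearMap.ker_eq_bot']
  intro x hx
  ext n
  induction n with
  | zero => rw [← h0, hx]
  | succ n ih =>
    have := hsucc x n
    rw [hx, ih] at this
    simpa using this.symm

/-- The map `e n ↦ 1 / (s 0 ⋯ s (n - 1))` to the localization. -/
noncomputable def telescopeCokernelMap {S : Submonoid R} {s : ℕ → R} (hs : IsExhausting S s) :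
    (ℕ →₀ R) →ₗ[R] Localization S :=
  Finsupp.linearCombination R fun n => Localization.mk 1 ⟨partialProd s n, hs.partialProd_mem n⟩

variable {S : Submonoid R} {s : ℕ → R} (hs : IsExhausting S s)

theorem telescopeCokernelMap_single (n : ℕ) (r : R) :
    telescopeCokernelMap hs (Finsupp.single n r) =
      Localization.mk r ⟨partialProd s n, hs.partialProd_mem n⟩ := by
  simp [telescopeCokernelMap, Localization.smul_mk]

theorem mk_partialProd_eq (n m : ℕ) (r : R) :
    Localization.mk r ⟨partialProd s n, hs.partialProd_mem n⟩ =
      Localization.mk (r * ∏ k ∈ Finset.range m, s (n + k))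
        ⟨partialProd s (n + m), hs.partialProd_mem (n + m)⟩ := by
  rw [Localization.mk_eq_mk_iff, Localization.r_iff_exists]
  exact ⟨1, by simp only [partialProd_add]; ring⟩

theorem telescopeCokernelMap_surjective : Function.Surjective (telescopeCokernelMap hs) := by
  intro x
  induction x using Localization.induction_on with
  | H x =>
    obtain ⟨r, u⟩ := x
    obtain ⟨m, v, hv⟩ := hs.dvd u u.2 0
    refine ⟨Finsupp.single m (r * v), ?_⟩
    rw [telescopeCokernelMap_single, Localization.mk_eq_mk_iff, Localization.r_iff_exists]
    have : partialProd s m = u * v := by simpa [partialProd] using hv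
    exact ⟨1, by simp only [this]; ring⟩

theorem single_sub_single_mem_range_telescopeMap (n m : ℕ) (r : R) :
    Finsupp.single n r - Finsupp.single (n + m) (r * ∏ k ∈ Finset.range m, s (n + k)) ∈
      LinearMap.range (telescopeMap s) := by
  induction m with
  | zero => simp
  | succ m ih =>
    have h : Finsupp.single (n + m) (r * ∏ k ∈ Finset.range m, s (n + k)) -
        Finsupp.single (n + (m + 1)) (r * ∏ k ∈ Finset.range (m + 1), s (n + k)) ∈
        LinearMap.range (telescopeMap s) := by
      refine ⟨(r * ∏ k ∈ Finset.range m, s (n + k)) • Finsupp.single (n + m) 1, ?_⟩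
      rw [map_smul, telescopeMap_single, smul_sub, Finset.prod_range_succ]
      simp [mul_assoc, add_assoc]
    simpa using Submodule.add_mem _ ih h

theorem exists_sub_single_mem_range_telescopeMap (s : ℕ → R) (x : ℕ →₀ R) :
    ∃ n r, x - Finsupp.single n r ∈ LinearMap.range (telescopeMap s) := by
  induction x using Finsupp.induction_linear with
  | zero => exact ⟨0, 0, by simp⟩
  | single n r => exact ⟨n, r, by simp⟩
  | add x y hx hy =>
    obtain ⟨n, a, ha⟩ := hx
    obtain ⟨m, b, hb⟩ := hy
    have h1 := single_sub_single_mem_range_telescopeMap (s := s) n m a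
    have h2 := single_sub_single_mem_range_telescopeMap (s := s) m n b
    rw [add_comm m n] at h2
    refine ⟨n + m, a * ∏ k ∈ Finset.range m, s (n + k) + b * ∏ k ∈ Finset.range n, s (m + k), ?_⟩
    rw [Finsupp.single_add]
    convert Submodule.add_mem _ (Submodule.add_mem _ ha h1) (Submodule.add_mem _ hb h2) using 1
    abel

theorem telescope_exact : Function.Exact (telescopeMap s) (telescopeCokernelMap hs) := by
  have h0 : ∀ x, telescopeCokernelMap hs (telescopeMap s x) = 0 := by
    have : telescopeCokernelMap hs ∘ₗ telescopeMap s = 0 := by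
      ext n
      simp only [LinearMap.comp_apply, Finsupp.lsingle_apply, telescopeMap_single, map_sub,
        map_smul, telescopeCokernelMap_single, LinearMap.zero_apply, sub_eq_zero]
      rw [mk_partialProd_eq hs n 1]
      simp [Localization.smul_mk]
    exact fun x => LinearMap.congr_fun this x
  intro x
  refine ⟨fun hx => ?_, by rintro ⟨y, rfl⟩; exact h0 y⟩
  obtain ⟨n, r, y, hy⟩ := exists_sub_single_mem_range_telescopeMap s x
  have h1 : telescopeCokernelMap hs (Finsupp.single n r) = 0 := by
    have := h0 y
    rw [hy, map_sub, hx, zero_sub, neg_eq_zero] at this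
    exact this
  rw [telescopeCokernelMap_single, ← Localization.mk_zero 1, Localization.mk_eq_mk_iff,
    Localization.r_iff_exists] at h1
  obtain ⟨c, hc⟩ := h1
  -- Divisibility starting at position `n` is essential here: an annihilator `c ∈ S` of `r` divides
  -- a product of later terms, so pushing `r` along the telescope makes it zero.
  obtain ⟨m, v, hv⟩ := hs.dvd c c.2 n
  have h2 := single_sub_single_mem_range_telescopeMap (s := s) n m r
  have h3 : r * ∏ k ∈ Finset.range m, s (n + k) = 0 := by
    have : (c : R) * r = 0 := by simpa using hc
    rw [hv, ← mul_assoc, mul_comm r, this, zero_mul]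
  rw [h3, Finsupp.single_zero, sub_zero] at h2
  obtain ⟨z, hz⟩ := h2
  exact ⟨y + z, by rw [map_add, hy, hz, sub_add_cancel]⟩

/-- The limit of the tower of multiplications is `Hom(S⁻¹R, C)`. -/
noncomputable def localizationHomEquiv (C : Type*) [AddCommGroup C] [Module R C] :
    (Localization S →ₗ[R] C) ≃ₗ[R] towerLimit (scaleTower C s) := by
  let π := telescopeCokernelMap hs
  let f : (Localization S →ₗ[R] C) →ₗ[R] towerLimit (scaleTower C s) :=
    LinearMap.codRestrict _ (LinearMap.pi fun n => LinearMap.applyₗ (π (Finsupp.single n 1)))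
      fun g => mem_towerLimit.2 fun n => by
        change g (π _) = s n • g (π _)
        have := (telescope_exact hs _).2 ⟨Finsupp.single n 1, rfl⟩
        rw [telescopeMap_single, map_sub, sub_eq_zero] at this
        rw [← map_smul, ← map_smul]
        exact congrArg g this
  refine LinearEquiv.ofBijective f ⟨fun g g' h => ?_, fun c => ?_⟩
  · have h1 : g ∘ₗ π = g' ∘ₗ π := by
      ext n
      exact congrFun (congrArg Subtype.val h) n
    refine LinearMap.ext fun x => ?_
    obtain ⟨y, rfl⟩ := telescopeCokernelMap_surjective hs x
    exact LinearMap.congr_fun h1 y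
  · let g : (ℕ →₀ R) →ₗ[R] C := Finsupp.linearCombination R c.1
    have hg : LinearMap.ker π ≤ LinearMap.ker g := by
      rw [(telescope_exact hs).linearMap_ker_eq]
      rintro _ ⟨y, rfl⟩
      have : g ∘ₗ telescopeMap s = 0 := by
        ext n
        have := mem_towerLimit.1 c.2 n
        simp [telescopeMap_single, g, sub_eq_zero]
        exact this
      exact LinearMap.congr_fun this y
    refine ⟨(LinearMap.ker π).liftQ g hg ∘ₗ
      (π.quotKerEquivOfSurjective (telescopeCokernelMap_surjective hs)).symm.toLinearMap,
      Subtype.ext (funext fun n => ?_)⟩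
    change (LinearMap.ker π).liftQ g hg ((π.quotKerEquivOfSurjective _).symm (π _)) = _
    have h1 : ∀ x, (π.quotKerEquivOfSurjective (telescopeCokernelMap_surjective hs)).symm (π x) =
        Submodule.Quotient.mk x := fun x => by
      rw [LinearEquiv.symm_apply_eq]; rfl
    rw [h1]
    simp [g]

-- Under the identification of the limit with `Hom(S⁻¹R, C)`, members of `S` act invertibly through
-- the source.
include hs in
theorem isUnit_algebraMap_end_towerLimit (C : Type*) [AddCommGroup C] [Module R C] (x : S) :
    IsUnit (algebraMap R (Module.End R (towerLimit (scaleTower C s))) x) := by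
  rw [Module.End.isUnit_iff]
  let e := localizationHomEquiv hs C
  obtain ⟨y, hy⟩ := (IsLocalization.map_units (Localization S) x).exists_right_inv
  have hbij : Function.Bijective fun f : Localization S →ₗ[R] C => (x : R) • f := by
    have hxy : ∀ z, (x : R) • (y * z) = z := fun z => by
      rw [Algebra.smul_def, ← mul_assoc, hy, one_mul]
    refine ⟨fun f g h => LinearMap.ext fun z => ?_, fun f => ⟨f ∘ₗ LinearMap.mulLeft R y, ?_⟩⟩
    · have := LinearMap.congr_fun h (y * z)
      simp only [LinearMap.smul_apply, ← map_smul, hxy] at this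
      exact this
    · refine LinearMap.ext fun z => ?_
      simp only [LinearMap.smul_apply, ← map_smul, LinearMap.comp_apply, LinearMap.mulLeft_apply,
        hxy]
  have h2 : ⇑(algebraMap R (Module.End R (towerLimit (scaleTower C s))) x) =
      e ∘ (fun f => (x : R) • f) ∘ e.symm := by
    ext1 c
    simp [Module.algebraMap_end_apply]
  rw [h2]
  exact e.bijective.comp (hbij.comp e.symm.bijective)

include hs in
theorem isLocalizedModule_id_towerLimit (C : Type*) [AddCommGroup C] [Module R C] :
    IsLocalizedModule S (LinearMap.id : towerLimit (scaleTower C s) →ₗ[R] _) where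
  map_units := isUnit_algebraMap_end_towerLimit hs C
  surj y := ⟨(y, 1), by simp⟩
  exists_of_eq h := ⟨1, by simpa using h⟩

/-- The limit of the tower of multiplications is an `S⁻¹R`-module. -/
noncomputable def localizedTowerLimitEquiv (C : Type*) [AddCommGroup C] [Module R C] :
    LocalizedModule S (towerLimit (scaleTower C s)) ≃ₗ[R] towerLimit (scaleTower C s) :=
  have := isLocalizedModule_id_towerLimit hs C
  IsLocalizedModule.iso S (LinearMap.id : towerLimit (scaleTower C s) →ₗ[R] _)

end Exhausting

/-! ### Vanishing of `Ext¹` as extension of maps and as vanishing of `lim¹` -/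

section Ext

open CategoryTheory

variable {R : Type u} [CommRing R]

/-- The short complex in `ModuleCat R` given by an exact pair of linear maps. -/
abbrev ModuleCat.shortComplexOfExact {K P F : Type (max u v)} [AddCommGroup K]
    [AddCommGroup P] [AddCommGroup F] [Module R K] [Module R P] [Module R F]
    (i : K →ₗ[R] P) (π : P →ₗ[R] F) (hex : Function.Exact i π) :
    ShortComplex (ModuleCat.{max u v} R) :=
  ShortComplex.mk (ModuleCat.ofHom i) (ModuleCat.ofHom π) (by
    rw [← ModuleCat.ofHom_comp, hex.linearMap_comp_eq_zero]; rfl)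

theorem ModuleCat.shortExact_shortComplexOfExact {K P F : Type (max u v)} [AddCommGroup K]
    [AddCommGroup P] [AddCommGroup F] [Module R K] [Module R P] [Module R F]
    (i : K →ₗ[R] P) (π : P →ₗ[R] F) (hi : Function.Injective i) (hex : Function.Exact i π)
    (hπ : Function.Surjective π) : (shortComplexOfExact i π hex).ShortExact where
  exact := (ShortComplex.ShortExact.moduleCat_exact_iff_function_exact _).2 hex
  mono_f := (ModuleCat.mono_iff_injective _).2 hi
  epi_g := (ModuleCat.epi_iff_surjective _).2 hπ

theorem subsingleton_ext_of_isCotorsion {C F : ModuleCat.{max u v} R}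
    (hC : IsCotorsion.{u, v} R C) (hF : Module.Flat R F) : Subsingleton (Abelian.Ext F C 1) := by
  let π : (F →₀ R) →ₗ[R] F := Finsupp.linearCombination R id
  have hπ : Function.Surjective π := fun k => ⟨Finsupp.single k 1, by simp [π]⟩
  let i : LinearMap.ker π →ₗ[R] (F →₀ R) := (LinearMap.ker π).subtype
  have hi : Function.Injective i := (LinearMap.ker π).subtype_injective
  have hex : Function.Exact i π := LinearMap.exact_subtype_ker_map π
  have hS := ModuleCat.shortExact_shortComplexOfExact.{u, v} (K := LinearMap.ker π)
    (P := F →₀ R) (F := F) i π hi hex hπ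
  have : Projective (ModuleCat.of R (F →₀ R)) :=
    (IsProjective.iff_projective (F →₀ R)).1 inferInstance
  refine subsingleton_of_forall_eq 0 fun x => ?_
  obtain ⟨y, rfl⟩ := Abelian.Ext.contravariant_sequence_exact₃ hS C x
    (Abelian.Ext.eq_zero_of_projective (P := ModuleCat.of R (F →₀ R)) _) (n₀ := 0) rfl
  obtain ⟨f, rfl⟩ := Abelian.Ext.addEquiv₀.symm.surjective y
  obtain ⟨g, hg⟩ := hC _ _ F inferInstance hF i π hi hex hπ f.hom
  have hf : f = (ModuleCat.shortComplexOfExact i π hex).f ≫ ModuleCat.ofHom g := by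
    ext1; exact hg.symm
  rw [Abelian.Ext.addEquiv₀_symm_apply, hf, ← Abelian.Ext.mk₀_comp_mk₀,
    ShortComplex.ShortExact.extClass_comp_assoc]

theorem exists_extension_of_subsingleton_ext {K P F C : Type (max u v)} [AddCommGroup K]
    [AddCommGroup P] [AddCommGroup F] [AddCommGroup C] [Module R K] [Module R P] [Module R F]
    [Module R C] (i : K →ₗ[R] P) (π : P →ₗ[R] F) (hi : Function.Injective i)
    (hex : Function.Exact i π) (hπ : Function.Surjective π)
    (h : Subsingleton (Abelian.Ext (ModuleCat.of R F) (ModuleCat.of R C) 1))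
    (f : K →ₗ[R] C) : ∃ g : P →ₗ[R] C, g ∘ₗ i = f := by
  have hS := ModuleCat.shortExact_shortComplexOfExact.{u, v} i π hi hex hπ
  obtain ⟨y, hy⟩ := Abelian.Ext.contravariant_sequence_exact₁ hS (ModuleCat.of R C)
    (Abelian.Ext.mk₀ (ModuleCat.ofHom f)) (n₁ := 1) rfl (Subsingleton.elim (α := Abelian.Ext
      (ModuleCat.of R F) (ModuleCat.of R C) 1) _ _)
  obtain ⟨g, rfl⟩ := Abelian.Ext.addEquiv₀.symm.surjective y
  rw [Abelian.Ext.addEquiv₀_symm_apply, Abelian.Ext.mk₀_comp_mk₀] at hy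
  have := Abelian.Ext.addEquiv₀.symm.injective hy
  exact ⟨g.hom, congrArg ModuleCat.Hom.hom this⟩

/-- A sequence in `C` is a linear map from the free module. Extending it along `telescopeMap s`
amounts to solving the shift equation, and the obstruction is in `Ext¹(S⁻¹R, C)`. -/
theorem towerShift_scaleTower_surjective {S : Submonoid R} {s : ℕ → R} (hs : IsExhausting S s)
    {C : ModuleCat.{max u v} R} (h : Subsingleton (Abelian.Ext
      (ModuleCat.of R (ULift.{v} (Localization S))) C 1)) :
    Function.Surjective (towerShift (scaleTower C s)) := by
  intro c
  let eP : ULift.{v} (ℕ →₀ R) ≃ₗ[R] (ℕ →₀ R) := ULift.moduleEquiv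
  let eF : ULift.{v} (Localization S) ≃ₗ[R] Localization S := ULift.moduleEquiv
  obtain ⟨g, hg⟩ := exists_extension_of_subsingleton_ext.{u, v}
    (eP.symm.toLinearMap ∘ₗ telescopeMap s ∘ₗ eP.toLinearMap)
    (eF.symm.toLinearMap ∘ₗ telescopeCokernelMap hs ∘ₗ eP.toLinearMap)
    (eP.symm.injective.comp ((telescopeMap_injective s).comp eP.injective))
    (fun x => by
      have := telescope_exact hs (eP x)
      simp only [LinearMap.comp_apply, LinearEquiv.coe_coe, map_eq_zero_iff _ eF.symm.injective]
      rw [this]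
      constructor
      · rintro ⟨y, hy⟩
        exact ⟨eP.symm y, eP.injective (by simpa using hy)⟩
      · rintro ⟨y, rfl⟩
        exact ⟨eP y, by simp⟩)
    (eF.symm.surjective.comp ((telescopeCokernelMap_surjective hs).comp eP.surjective)) h
    (Finsupp.linearCombination R c ∘ₗ eP.toLinearMap)
  refine ⟨fun n => g (eP.symm (Finsupp.single n 1)), funext fun n => ?_⟩
  have := LinearMap.congr_fun hg (eP.symm (Finsupp.single n 1))
  simp only [LinearMap.comp_apply, LinearEquiv.coe_coe, LinearEquiv.apply_symm_apply,
    telescopeMap_single, map_sub, map_smul, Finsupp.linearCombination_single, one_smul] at this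
  exact this

end Ext

/-! ### Choice of the two multiplicative subsets by prime avoidance -/

section Primes

variable {R : Type u} [CommRing R]

theorem not_lt_of_ringKrullDim_eq_two (hdim : ringKrullDim R = 2) {a b c d : PrimeSpectrum R}
    (hab : a < b) (hbc : b < c) : ¬ c < d := fun hcd => by
  let l : LTSeries (PrimeSpectrum R) :=
    { length := 3
      toFun := ![a, b, c, d]
      step := fun i => by fin_cases i <;> simpa }
  have h : ((3 : ℕ) : WithBot ℕ∞) ≤ ringKrullDim R := Order.LTSeries.length_le_krullDim l
  rw [hdim] at h
  exact absurd h (by decide)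

/-- The nonmaximal primes meeting a given set. -/
def nonmaximalPrimesMeeting (T : Set R) : Set (PrimeSpectrum R) :=
  {P | ¬ IsMax P ∧ ∃ t ∈ T, t ∈ P.asIdeal}

variable [IsNoetherianRing R]

theorem finite_isMin_primeSpectrum : {P : PrimeSpectrum R | IsMin P}.Finite := by
  refine Set.Finite.of_finite_image (f := PrimeSpectrum.asIdeal)
    ((minimalPrimes.finite_of_isNoetherianRing R).subset ?_)
    (fun P _ Q _ h => PrimeSpectrum.ext h)
  rintro _ ⟨P, hP, rfl⟩
  exact ⟨⟨P.2, bot_le⟩, fun Q hQ hQP => hP (b := ⟨Q, hQ.1⟩) hQP⟩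

/-- A nonmaximal prime containing `t ∈ T` is minimal over `t`: otherwise a smaller prime containing
`t`, itself not minimal, would give a chain of length three. A Noetherian ring has finitely many
such primes for each `t`. -/
theorem finite_nonmaximalPrimesMeeting (hdim : ringKrullDim R = 2) (T : Finset R)
    (hT : ∀ t ∈ T, ∀ P : PrimeSpectrum R, IsMin P → t ∉ P.asIdeal) :
    (nonmaximalPrimesMeeting (T : Set R)).Finite := by
  have h : nonmaximalPrimesMeeting (T : Set R) ⊆
      ⋃ t ∈ T, PrimeSpectrum.asIdeal ⁻¹' (Ideal.span {t}).minimalPrimes := by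
    rintro P ⟨hP, t, ht, htP⟩
    refine Set.mem_biUnion ht ⟨⟨P.2, by simpa [Ideal.span_le] using htP⟩, ?_⟩
    rintro Q ⟨hQ, htQ⟩ hQP
    by_contra hPQ
    obtain ⟨M, hM⟩ := not_isMax_iff.1 hP
    have hlt : (⟨Q, hQ⟩ : PrimeSpectrum R) < P := lt_of_le_not_ge hQP hPQ
    have hmin : ¬ IsMin (⟨Q, hQ⟩ : PrimeSpectrum R) := fun hmin =>
      hT t ht _ hmin (by simpa [Ideal.span_le] using htQ)
    obtain ⟨N, hN⟩ := not_isMin_iff.1 hmin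
    exact not_lt_of_ringKrullDim_eq_two hdim hN hlt hM
  refine Set.Finite.subset (T.finite_toSet.biUnion fun t _ => ?_) h
  exact (Ideal.finite_minimalPrimes_of_isNoetherianRing R _).preimage
    fun P _ Q _ h => PrimeSpectrum.ext h

/-- Two finite sets of elements outside all minimal primes such that no nonmaximal prime meets
both sets. -/
structure IsSeparated (T U : Finset R) : Prop where
  left : ∀ t ∈ T, ∀ P : PrimeSpectrum R, IsMin P → t ∉ P.asIdeal
  right : ∀ t ∈ U, ∀ P : PrimeSpectrum R, IsMin P → t ∉ P.asIdeal
  disjoint : ∀ P ∈ nonmaximalPrimesMeeting (T : Set R), P ∉ nonmaximalPrimesMeeting (U : Set R)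

omit [IsNoetherianRing R] in
theorem IsSeparated.symm {T U : Finset R} (h : IsSeparated T U) : IsSeparated U T :=
  ⟨h.right, h.left, fun P hU hT => h.disjoint P hT hU⟩

theorem IsSeparated.exists_insert (hdim : ringKrullDim R = 2) {T U : Finset R}
    (h : IsSeparated T U) (Q : PrimeSpectrum R) :
    ∃ T', T ⊆ T' ∧ IsSeparated T' U ∧
      (¬ IsMin Q → Q ∉ nonmaximalPrimesMeeting (U : Set R) → ∃ t ∈ T', t ∈ Q.asIdeal) := by
  classical
  by_cases hQ : IsMin Q ∨ Q ∈ nonmaximalPrimesMeeting (U : Set R)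
  · exact ⟨T, subset_rfl, h, fun h1 h2 => (hQ.elim h1 h2).elim⟩
  push Not at hQ
  obtain ⟨W, hW⟩ := (finite_isMin_primeSpectrum.union
    (finite_nonmaximalPrimesMeeting hdim U h.right)).exists_finset
  -- Prime avoidance: the new element is to lie in `Q`, outside all minimal primes and outside the
  -- finitely many nonmaximal primes meeting `U`.
  have hQW : ¬ ((Q.asIdeal : Set R) ⊆ ⋃ P ∈ (W : Set (PrimeSpectrum R)), P.asIdeal) := by
    rw [Ideal.subset_union_prime Q Q fun P _ _ _ => P.2]
    rintro ⟨P, hP, hQP⟩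
    rcases (hW P).1 hP with hP | hP
    · exact hQ.1 (hP.mono hQP)
    · rcases eq_or_lt_of_le (show Q ≤ P from hQP) with rfl | hlt
      · exact hQ.2 hP
      · obtain ⟨M, hM⟩ := not_isMax_iff.1 hP.1
        obtain ⟨N, hN⟩ := not_isMin_iff.1 hQ.1
        exact not_lt_of_ringKrullDim_eq_two hdim hN hlt hM
  obtain ⟨t, htQ, ht⟩ := Set.not_subset.1 hQW
  have ht' : ∀ P, IsMin P ∨ P ∈ nonmaximalPrimesMeeting (U : Set R) → t ∉ P.asIdeal :=
    fun P hP htP => ht (Set.mem_biUnion ((hW P).2 hP) htP)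
  refine ⟨insert t T, Finset.subset_insert t T, ⟨fun r hr P hP => ?_, h.right, ?_⟩,
    fun _ _ => ⟨t, Finset.mem_insert_self t T, htQ⟩⟩
  · rcases Finset.mem_insert.1 hr with rfl | hr
    · exact ht' P (Or.inl hP)
    · exact h.left r hr P hP
  · rintro P ⟨hP, r, hr, hrP⟩ hPU
    rcases Finset.mem_insert.1 hr with rfl | hr
    · exact ht' P (Or.inr hPU) hrP
    · exact h.disjoint P ⟨hP, r, hr, hrP⟩ hPU

theorem IsSeparated.exists_extension (hdim : ringKrullDim R = 2) {T U : Finset R}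
    (h : IsSeparated T U) (Q : PrimeSpectrum R) :
    ∃ T' U', T ⊆ T' ∧ U ⊆ U' ∧ IsSeparated T' U' ∧
      (¬ IsMin Q → Q ∈ nonmaximalPrimesMeeting (U' : Set R) ∨ ∃ t ∈ T', t ∈ Q.asIdeal) ∧
      (¬ IsMin Q → Q ∈ nonmaximalPrimesMeeting (T' : Set R) ∨ ∃ t ∈ U', t ∈ Q.asIdeal) := by
  obtain ⟨T', hT, h', hQ⟩ := h.exists_insert hdim Q
  obtain ⟨U', hU, h'', hQ'⟩ := h'.symm.exists_insert hdim Q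
  refine ⟨T', U', hT, hU, h''.symm, fun hmin => ?_, fun hmin => ?_⟩
  · by_cases hm : Q ∈ nonmaximalPrimesMeeting (U : Set R)
    · obtain ⟨hm, t, ht, htQ⟩ := hm
      exact Or.inl ⟨hm, t, hU ht, htQ⟩
    · exact Or.inr (hQ hmin hm)
  · by_cases hm : Q ∈ nonmaximalPrimesMeeting (T' : Set R)
    · exact Or.inl hm
    · exact Or.inr (hQ' hmin hm)

theorem exists_separating_sets (hdim : ringKrullDim R = 2)
    (hspec : Countable (PrimeSpectrum R)) :
    ∃ T U : Set R, T.Countable ∧ U.Countable ∧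
      (∀ t ∈ T, ∀ P : PrimeSpectrum R, IsMin P → t ∉ P.asIdeal) ∧
      (∀ t ∈ U, ∀ P : PrimeSpectrum R, IsMin P → t ∉ P.asIdeal) ∧
      (∀ P ∈ nonmaximalPrimesMeeting T, P ∉ nonmaximalPrimesMeeting U) ∧
      (∀ Q : PrimeSpectrum R, ¬ IsMin Q →
        Q ∈ nonmaximalPrimesMeeting U ∨ ∃ t ∈ T, t ∈ Q.asIdeal) ∧
      (∀ Q : PrimeSpectrum R, ¬ IsMin Q →
        Q ∈ nonmaximalPrimesMeeting T ∨ ∃ t ∈ U, t ∈ Q.asIdeal) := by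
  have : Nonempty (PrimeSpectrum R) := by
    by_contra hne
    rw [not_nonempty_iff] at hne
    have : ringKrullDim R = ⊥ := Order.krullDim_eq_bot
    rw [hdim] at this
    exact absurd this (by decide)
  obtain ⟨Q, hQ⟩ := exists_surjective_nat (PrimeSpectrum R)
  choose nT nU hnT hnU hsep hnQ hnQ' using
    fun (p : {p : Finset R × Finset R // IsSeparated p.1 p.2}) (n : ℕ) =>
      p.2.exists_extension hdim (Q n)
  let st : ℕ → {p : Finset R × Finset R // IsSeparated p.1 p.2} := fun n =>
    Nat.rec ⟨(∅, ∅), ⟨by simp, by simp, by simp [nonmaximalPrimesMeeting]⟩⟩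
      (fun n p => ⟨(nT p n, nU p n), hsep p n⟩) n
  have hmonoT : Monotone fun n => (st n).1.1 := monotone_nat_of_le_succ fun n => hnT (st n) n
  have hmonoU : Monotone fun n => (st n).1.2 := monotone_nat_of_le_succ fun n => hnU (st n) n
  refine ⟨⋃ n, ((st n).1.1 : Set R), ⋃ n, ((st n).1.2 : Set R),
    Set.countable_iUnion fun n => Finset.countable_toSet _,
    Set.countable_iUnion fun n => Finset.countable_toSet _, ?_, ?_, ?_, ?_, ?_⟩
  · intro t ht
    obtain ⟨n, hn⟩ := Set.mem_iUnion.1 ht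
    exact (st n).2.left t hn
  · intro t ht
    obtain ⟨n, hn⟩ := Set.mem_iUnion.1 ht
    exact (st n).2.right t hn
  · rintro P ⟨hP, t, ht, htP⟩ ⟨-, r, hr, hrP⟩
    obtain ⟨n, hn⟩ := Set.mem_iUnion.1 ht
    obtain ⟨m, hm⟩ := Set.mem_iUnion.1 hr
    exact (st (max n m)).2.disjoint P ⟨hP, t, hmonoT (le_max_left n m) hn, htP⟩
      ⟨hP, r, hmonoU (le_max_right n m) hm, hrP⟩
  · intro P hP
    obtain ⟨n, rfl⟩ := hQ P
    rcases hnQ (st n) n hP with ⟨h, t, ht, htP⟩ | ⟨t, ht, htP⟩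
    · exact Or.inl ⟨h, t, Set.mem_iUnion.2 ⟨n + 1, ht⟩, htP⟩
    · exact Or.inr ⟨t, Set.mem_iUnion.2 ⟨n + 1, ht⟩, htP⟩
  · intro P hP
    obtain ⟨n, rfl⟩ := hQ P
    rcases hnQ' (st n) n hP with ⟨h, t, ht, htP⟩ | ⟨t, ht, htP⟩
    · exact Or.inl ⟨h, t, Set.mem_iUnion.2 ⟨n + 1, ht⟩, htP⟩
    · exact Or.inr ⟨t, Set.mem_iUnion.2 ⟨n + 1, ht⟩, htP⟩

omit [IsNoetherianRing R] in
theorem countable_submonoid_closure {T : Set R} (hT : T.Countable) :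
    (Submonoid.closure T : Set R).Countable := by
  have := hT.to_subtype
  rw [Submonoid.closure_eq_mrange, MonoidHom.coe_mrange]
  exact Set.countable_range _

omit [IsNoetherianRing R] in
theorem exists_mem_of_mem_closure {T : Set R} {t : R} (ht : t ∈ Submonoid.closure T)
    (P : PrimeSpectrum R) (htP : t ∈ P.asIdeal) : ∃ r ∈ T, r ∈ P.asIdeal := by
  by_contra! h
  have : Submonoid.closure T ≤ P.asIdeal.primeCompl := Submonoid.closure_le.2 h
  exact this ht htP

/-- In dimension two with countable spectrum there are countable multiplicative subsets `S`, `T`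
such that the rings obtained from `R` by inverting or killing members of `S` and of `T` have
dimension zero. -/
theorem exists_separating_submonoids (hdim : ringKrullDim R = 2)
    (hspec : Countable (PrimeSpectrum R)) :
    ∃ S T : Submonoid R, (S : Set R).Countable ∧ (T : Set R).Countable ∧
      ∀ P Q : PrimeSpectrum R, P < Q →
        ((∃ s ∈ S, s ∈ Q.asIdeal) ∨ ∃ t ∈ T, t ∈ Q.asIdeal) ∧
        ((∃ s ∈ S, s ∈ P.asIdeal) → ∃ t ∈ T, t ∈ Q.asIdeal) ∧
        ((∃ t ∈ T, t ∈ P.asIdeal) → ∃ s ∈ S, s ∈ Q.asIdeal) ∧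
        ((∃ s ∈ S, s ∈ P.asIdeal) → ∀ t ∈ T, t ∉ P.asIdeal) := by
  obtain ⟨T, U, hT, hU, hTmin, hUmin, hTU, hmT, hmU⟩ := exists_separating_sets hdim hspec
  refine ⟨Submonoid.closure T, Submonoid.closure U, countable_submonoid_closure hT,
    countable_submonoid_closure hU, fun P Q hPQ => ?_⟩
  have hQ : ¬ IsMin Q := hPQ.not_isMin
  have hP : ¬ IsMax P := hPQ.not_isMax
  have hlift : ∀ {V : Set R}, (∃ r ∈ V, r ∈ Q.asIdeal) →
      ∃ r ∈ Submonoid.closure V, r ∈ Q.asIdeal := fun ⟨r, hr, hrQ⟩ =>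
    ⟨r, Submonoid.subset_closure hr, hrQ⟩
  -- A prime meeting `V` is not minimal, so any prime strictly above it is maximal. Maximality of
  -- `Q` then forces it to meet the other set as well.
  have hmax : ∀ {V : Set R}, (∀ t ∈ V, ∀ P : PrimeSpectrum R, IsMin P → t ∉ P.asIdeal) →
      (∃ r ∈ V, r ∈ P.asIdeal) → IsMax Q := by
    rintro V hV ⟨r, hr, hrP⟩
    by_contra hmaxQ
    obtain ⟨M, hM⟩ := not_isMax_iff.1 hmaxQ
    obtain ⟨N, hN⟩ := not_isMin_iff.1 fun hmin => hV r hr P hmin hrP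
    exact not_lt_of_ringKrullDim_eq_two hdim hN hPQ hM
  refine ⟨?_, ?_, ?_, ?_⟩
  · rcases hmT Q hQ with h | h
    · exact Or.inr (hlift h.2)
    · exact Or.inl (hlift h)
  · rintro ⟨s, hs, hsP⟩
    have h := exists_mem_of_mem_closure hs P hsP
    exact hlift ((hmU Q hQ).resolve_left fun h' => h'.1 (hmax hTmin h))
  · rintro ⟨s, hs, hsP⟩
    have h := exists_mem_of_mem_closure hs P hsP
    exact hlift ((hmT Q hQ).resolve_left fun h' => h'.1 (hmax hUmin h))
  · rintro ⟨s, hs, hsP⟩ t ht htP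
    exact hTU P ⟨hP, exists_mem_of_mem_closure hs P hsP⟩
      ⟨hP, exists_mem_of_mem_closure ht P htP⟩

end Primes

/-! ### Artinian localizations and quotients, and cotorsion limits -/

section Dimension

variable {R : Type u} [CommRing R]

/-- A strict inclusion of primes of `B` contracts to a strict inclusion `P < Q` in `R`. But `Q`
cannot contain an element that becomes a unit, and `P` must contain every element that becomes zero.
So `B` has dimension zero. -/
theorem isArtinianRing_of_forall_lt {B : Type*} [CommRing B] [IsNoetherianRing B] (f : R →+* B)
    (hf : Function.Injective (PrimeSpectrum.comap f))
    (h : ∀ P Q : PrimeSpectrum R, P < Q →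
      (∃ r ∈ Q.asIdeal, IsUnit (f r)) ∨ ∃ r ∉ P.asIdeal, f r = 0) : IsArtinianRing B := by
  have : Ring.KrullDimLE 0 B := Ring.KrullDimLE.mk₀ fun I hI => by
    obtain ⟨M, hM, hIM⟩ := Ideal.exists_le_maximal I hI.ne_top
    rcases eq_or_lt_of_le hIM with rfl | hlt
    · exact hM
    exfalso
    have hle : PrimeSpectrum.comap f ⟨I, hI⟩ ≤ PrimeSpectrum.comap f ⟨M, hM.isPrime⟩ :=
      Ideal.comap_mono hIM
    have hne : PrimeSpectrum.comap f ⟨I, hI⟩ ≠ PrimeSpectrum.comap f ⟨M, hM.isPrime⟩ :=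
      fun heq => hlt.ne (congrArg PrimeSpectrum.asIdeal (hf heq))
    rcases h _ _ (lt_of_le_of_ne hle hne) with ⟨r, hr, hu⟩ | ⟨r, hr, h0⟩
    · exact hM.ne_top (Ideal.eq_top_of_isUnit_mem M hr hu)
    · exact hr (show f r ∈ I from h0 ▸ I.zero_mem)
  exact IsNoetherianRing.isArtinianRing_of_krullDimLE_zero

theorem isCotorsion_towerLimit_of_isArtinianRing {S : Submonoid R} {s : ℕ → R}
    (hs : IsExhausting S s) (hS : IsArtinianRing (Localization S)) (C : Type (max u v))
    [AddCommGroup C] [Module R C] : IsCotorsion.{u, v} R (towerLimit (scaleTower C s)) := by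
  have h : IsCotorsion.{u, v} (Localization S)
      (LocalizedModule S (towerLimit (scaleTower C s))) := IsCotorsion.of_isArtinianRing
  exact h.restrictScalars.of_equiv (localizedTowerLimitEquiv hs C)

theorem isCotorsion_of_smul_eq_zero (I : Ideal R) (hI : IsArtinianRing (R ⧸ I))
    {N : Type (max u v)} [AddCommGroup N] [Module R N] (h : ∀ a ∈ I, ∀ x : N, a • x = 0) :
    IsCotorsion.{u, v} R N :=
  IsCotorsion.of_isTorsionBySet I (fun _ _ _ => IsCotorsion.of_isArtinianRing)
    fun x a => h a a.2 x

theorem isCotorsion_of_isArtinianRing_quotient {S : Submonoid R} {s : ℕ → R}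
    (hs : IsExhausting S s) (hS : IsArtinianRing (Localization S))
    (hquot : ∀ a ∈ S, IsArtinianRing (R ⧸ Ideal.span {a})) {C : Type (max u v)}
    [AddCommGroup C] [Module R C] (h : Function.Surjective (towerShift (scaleTower C s))) :
    IsCotorsion.{u, v} R C := by
  refine IsCotorsion.of_scaleTower s ⟨h, isCotorsion_towerLimit_of_isArtinianRing hs hS C⟩
    fun n N _ _ hN => isCotorsion_of_smul_eq_zero _ (hquot _ (hs.partialProd_mem n)) ?_
  intro a ha x
  obtain ⟨b, rfl⟩ := Ideal.mem_span_singleton'.1 ha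
  rw [mul_smul, hN, smul_zero]

theorem isCotorsion_towerLimit_of_forall_lt [IsNoetherianRing R] {S T : Submonoid R}
    {s t : ℕ → R} (hs : IsExhausting S s) (ht : IsExhausting T t)
    (hST : ∀ P Q : PrimeSpectrum R, P < Q →
      ((∃ s ∈ S, s ∈ Q.asIdeal) ∨ ∃ t ∈ T, t ∈ Q.asIdeal) ∧
      ((∃ t ∈ T, t ∈ P.asIdeal) → ∃ s ∈ S, s ∈ Q.asIdeal))
    {C : Type (max u v)} [AddCommGroup C] [Module R C]
    (h : Function.Surjective (towerShift (scaleTower C (s * t)))) :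
    IsCotorsion.{u, v} R (towerLimit (scaleTower C s)) := by
  let A := Localization S
  let φ := algebraMap R A
  have hφ : Function.Injective (PrimeSpectrum.comap φ) :=
    PrimeSpectrum.localization_comap_injective A S
  have hunit : ∀ r ∈ S, IsUnit (φ r) := fun r hr => IsLocalization.map_units A ⟨r, hr⟩
  let M := LocalizedModule S (towerLimit (scaleTower C s))
  let e : M ≃ₗ[R] towerLimit (scaleTower C s) := localizedTowerLimitEquiv hs C
  suffices hM : IsCotorsion.{u, v} A M from hM.restrictScalars.of_equiv e
  -- The one-sequence criterion over `A = S⁻¹R`, for the image of `T`. Its `lim¹` condition on `M`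
  -- comes from the diagonal argument for `s * t`.
  refine isCotorsion_of_isArtinianRing_quotient (ht.map φ) ?_ ?_ ?_
  · let B := Localization (T.map φ)
    refine isArtinianRing_of_forall_lt ((algebraMap A B).comp φ) ?_ fun P Q hPQ => Or.inl ?_
    · exact hφ.comp (PrimeSpectrum.localization_comap_injective B (T.map φ))
    · rcases (hST P Q hPQ).1 with ⟨r, hr, hrQ⟩ | ⟨r, hr, hrQ⟩
      · exact ⟨r, hrQ, (hunit r hr).map (algebraMap A B)⟩
      · exact ⟨r, hrQ, IsLocalization.map_units B (⟨φ r, r, hr, rfl⟩ : T.map φ)⟩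
  · rintro _ ⟨a, ha, rfl⟩
    refine isArtinianRing_of_forall_lt ((Ideal.Quotient.mk (Ideal.span {φ a})).comp φ) ?_
      fun P Q hPQ => ?_
    · exact hφ.comp (PrimeSpectrum.comap_injective_of_surjective _ Ideal.Quotient.mk_surjective)
    · by_cases haP : a ∈ P.asIdeal
      · obtain ⟨r, hr, hrQ⟩ := (hST P Q hPQ).2 ⟨a, ha, haP⟩
        exact Or.inl ⟨r, hrQ, (hunit r hr).map (Ideal.Quotient.mk (Ideal.span {φ a}))⟩
      · exact Or.inr ⟨a, haP, Ideal.Quotient.eq_zero_iff_mem.2 (Ideal.mem_span_singleton_self _)⟩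
  · intro m
    obtain ⟨c, hc⟩ := towerShift_scaleTower_towerLimit_surjective s t h fun n => e (m n)
    refine ⟨fun n => e.symm (c n), funext fun n => e.injective ?_⟩
    have := congrFun hc n
    simp only [towerShift_apply, scaleTower_apply] at this ⊢
    rw [map_sub, algebraMap_smul, map_smul, e.apply_symm_apply, e.apply_symm_apply, this]

end Dimension

theorem mainTheorem12 (R : Type u) [CommRing R] [IsNoetherianRing R]
    (hdim : ringKrullDim R = 2) (hspec : Countable (PrimeSpectrum R)) :
    ∃ S₁ S₂ : Submonoid R, (S₁ : Set R).Countable ∧ (S₂ : Set R).Countable ∧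
      ∀ F : ModuleCat.{max u v} R, Module.Flat R F →
        IsStronglyFlat.{u, v} (prodFamily ![S₁, S₂]) F := by
  obtain ⟨S, T, hS, hT, hST⟩ := exists_separating_submonoids hdim hspec
  refine ⟨S, T, hS, hT, fun F hF C hC => subsingleton_ext_of_isCotorsion ?_ hF⟩
  obtain ⟨s, hs⟩ := exists_isExhausting S hS
  obtain ⟨t, ht⟩ := exists_isExhausting T hT
  have hsS : IsExhausting (prodFamily ![S, T] {0}) s := by simpa [prodFamily] using hs
  have htT : IsExhausting (prodFamily ![S, T] {1}) t := by simpa [prodFamily] using ht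
  have hstST : IsExhausting (prodFamily ![S, T] Finset.univ) (s * t) := by
    have : prodFamily ![S, T] Finset.univ = S ⊔ T := by
      rw [show (Finset.univ : Finset (Fin 2)) = {0, 1} from rfl, prodFamily, Finset.iSup_insert,
        Finset.iSup_singleton]
      rfl
    rw [this]
    exact hs.mul ht
  have h₁ := towerShift_scaleTower_surjective hsS (hC {0})
  have h₂ := towerShift_scaleTower_surjective htT (hC {1})
  have h₁₂ := towerShift_scaleTower_surjective hstST (hC Finset.univ)
  have hart : IsArtinianRing (Localization (S ⊔ T)) := by
    refine isArtinianRing_of_forall_lt (algebraMap R _)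
      (PrimeSpectrum.localization_comap_injective _ (S ⊔ T)) fun P Q hPQ => Or.inl ?_
    rcases (hST P Q hPQ).1 with ⟨r, hr, hrQ⟩ | ⟨r, hr, hrQ⟩
    · exact ⟨r, hrQ, IsLocalization.map_units _ (⟨r, Submonoid.mem_sup_left hr⟩ : ↥(S ⊔ T))⟩
    · exact ⟨r, hrQ, IsLocalization.map_units _ (⟨r, Submonoid.mem_sup_right hr⟩ : ↥(S ⊔ T))⟩
  refine IsCotorsion.of_scaleTower_two s t
    ⟨h₁₂, isCotorsion_towerLimit_of_isArtinianRing (hs.mul ht) hart C⟩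
    ⟨h₁, isCotorsion_towerLimit_of_forall_lt hs ht
      (fun P Q hPQ => ⟨(hST P Q hPQ).1, (hST P Q hPQ).2.2.1⟩) h₁₂⟩
    ⟨h₂, isCotorsion_towerLimit_of_forall_lt ht hs
      (fun P Q hPQ => ⟨(hST P Q hPQ).1.symm, (hST P Q hPQ).2.1⟩) (mul_comm s t ▸ h₁₂)⟩ ?_
  intro n N _ _ h h'
  let a := partialProd s n
  let b := partialProd t n
  refine isCotorsion_of_smul_eq_zero (Ideal.span {a, b}) ?_ ?_
  · refine isArtinianRing_of_forall_lt (Ideal.Quotient.mk _)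
      (PrimeSpectrum.comap_injective_of_surjective _ Ideal.Quotient.mk_surjective)
      fun P Q hPQ => Or.inr ?_
    -- The prime `P` is not maximal, so it cannot contain both `a ∈ S` and `b ∈ T`; one of them is
    -- the element outside `P` that dies in the quotient.
    by_cases ha : a ∈ P.asIdeal
    · exact ⟨b, (hST P Q hPQ).2.2.2 ⟨a, hs.partialProd_mem n, ha⟩ b (ht.partialProd_mem n),
        Ideal.Quotient.eq_zero_iff_mem.2 (Ideal.subset_span (by simp))⟩
    · exact ⟨a, ha, Ideal.Quotient.eq_zero_iff_mem.2 (Ideal.subset_span (by simp))⟩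
  · intro r hr x
    obtain ⟨c, d, rfl⟩ := Ideal.mem_span_pair.1 hr
    rw [add_smul, mul_smul, mul_smul, h, h', smul_zero, smul_zero, add_zero]
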